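/- Let $\gamma\in(0,\sqrt2)$ and $\alpha\in(0,1)$. Let $(x_n)_{n\ge 1}$ be independent standard Gaussian variables, realized as the coordinates of $\Omega=\mathbb{R}^{\mathbb{N}^*}$ equipped with the cylinder $\sigma$-algebra and the Gaussian product measure $\mathbb{P}$. For $k\ge 1$ let $$\varphi^{h,k}(\theta)=\sum_{0<|n|\le k}\varphi_n e^{in\theta},\qquad \varphi_n=\varphi_{-n}=\frac{\sqrt2\,x_n}{2\sqrt n}\quad (n\ge1),$$ be the truncations of the centred Gaussian field $\varphi^h$ on the half-circle (with covariance $-\log(|e^{i\theta}-e^{i\theta'}||e^{i\theta}-e^{-i\theta'}|)$), and set $$W^{(k)}_\alpha(\varphi^h,B)=\int_B e^{\gamma\varphi^{h,k}(\theta)-\frac{\gamma^2}{2}\mathbb{E}[\varphi^{h,k}(\theta)^2]}\Big(\frac{1}{2|\sin\theta|}\Big)^{\alpha}d\theta\quad(B\subset(0,\pi)\text{ Borel}),$$ $$V^{(k)}_\alpha(\varphi^h)=\int_0^\pi e^{\gamma\varphi^{h,k}(\theta)-\frac{\gamma^2}{2}\mathbb{E}[\varphi^{h,k}(\theta)^2]}\Big(\frac{1}{2|\sin\theta|+\frac1k}\Big)^{\alpha}d\theta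 .$$ Almost surely, the measures $W^{(k)}_\alpha(\varphi^h,d\theta)$ converge vaguely on the open interval $(0,\pi)$ as $k\to\infty$ to a Radon measure $V_\alpha(\varphi^h,d\theta)$ on $(0,\pi)$. Let $V_\alpha(\varphi^h)=\sup_B V_\alpha(\varphi^h,B)\in[0,\infty]$ be its total mass, where the supremum runs over the closed sets $B\subset\mathbb{R}$ with $B\subset(0,\pi)$. Then, almost surely, $V_\alpha(\varphi^h)<\infty$ and $$V_\alpha(\varphi^h)=\lim_{k\to\infty}V^{(k)}_\alpha(\varphi^h)=\lim_{k\to\infty}W^{(k)}_\alpha(\varphi^h,(0,\pi)).$$ Moreover, set $$p_2=\tfrac12\Big(1-\tfrac{\alpha}{\gamma^2}\Big)+\sqrt{\tfrac1{\gamma^2}+\tfrac14\Big(1-\tfrac{\alpha}{\gamma^2}\Big)^2}.$$ Then $p_2>1$, and for every real $p$ with $0<p<p_2$ and $p<2/\gamma^2$ the variables $V_\alpha(\varphi^h)$, $V^{(k)}_\alpha(\varphi^h)$ and $W^{(k)}_\alpha(\varphi^h,(0,\pi))$ ($k\ge1$) have finite moments of order $p$, and both convergences also hold in $L^p(\Omega)$,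 that is, $$\mathbb{E}\big[|V^{(k)}_\alpha(\varphi^h)-V_\alpha(\varphi^h)|^p\big]\to0,\qquad \mathbb{E}\big[|W^{(k)}_\alpha(\varphi^h,(0,\pi))-V_\alpha(\varphi^h)|^p\big]\to0 .$$ -/

import Mathlib

noncomputable section

namespace HalfCircleGMC

open MeasureTheory ProbabilityTheory Filter Topology
open scoped ENNReal

/-- The sample space `ℝ^{ℕ*}` of sequences `(x_n)_{n ≥ 1}`, with the cylinder sigma-algebra. -/
abbrev Sample : Type := ℕ+ → ℝ

/-- The law of a sequence of independent standard Gaussian variables. -/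
def gaussLaw : Measure Sample := Measure.infinitePi fun _ : ℕ+ => gaussianReal 0 1

/-- The Fourier coefficient `φ_n = φ_{-n} = √2 x_n / (2 √n)`, for `n ≥ 1`. -/
def fourierCoeff (x : Sample) (n : ℕ+) : ℝ :=
  Real.sqrt 2 * x n / (2 * Real.sqrt (n : ℝ))

/-- The truncated field `φ^{h,k}(θ) = ∑_{0 < |n| ≤ k} φ_n e^{inθ}`. As `φ_n = φ_{-n}`, the terms of
index `n` and `-n` add up to `2 φ_n cos (n θ)`. -/
def field (k : ℕ) (x : Sample) (θ : ℝ) : ℝ :=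
  ∑ n ∈ Finset.range k,
    2 * fourierCoeff x n.succPNat * Real.cos ((n.succPNat : ℝ) * θ)

/-- The variance `E[φ^{h,k}(θ)^2]`. -/
def fieldVar (k : ℕ) (θ : ℝ) : ℝ := ∫ x, field k x θ ^ 2 ∂gaussLaw

/-- The Wick exponential `exp (γ φ^{h,k}(θ) - (γ^2 / 2) E[φ^{h,k}(θ)^2])`. -/
def wickExp (γ : ℝ) (k : ℕ) (x : Sample) (θ : ℝ) : ℝ :=
  Real.exp (γ * field k x θ - γ ^ 2 / 2 * fieldVar k θ)

/-- The density of the random measure `W_α^{(k)}(φ^h, dθ)` on `(0, π)`. -/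
def wDensity (γ α : ℝ) (k : ℕ) (x : Sample) (θ : ℝ) : ℝ :=
  wickExp γ k x θ * (1 / (2 * |Real.sin θ|)) ^ α

/-- The mass `W_α^{(k)}(φ^h, (0, π))`. -/
def wMass (γ α : ℝ) (k : ℕ) (x : Sample) : ℝ :=
  ∫ θ in (0 : ℝ)..Real.pi, wDensity γ α k x θ

/-- The regularized mass `V_α^{(k)}(φ^h)`, with the weight `(2|sin θ| + 1/k)^{-α}`. -/
def vMass (γ α : ℝ) (k : ℕ) (x : Sample) : ℝ :=
  ∫ θ in (0 : ℝ)..Real.pi, wickExp γ k x θ * (1 / (2 * |Real.sin θ| + 1 / (k : ℝ))) ^ α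

/-- `M` is a Radon measure on the open interval `(0, π)` (seen as a measure on `ℝ` that does not
charge the complement), and it is the vague limit there of the measures
`W_α^{(k)}(φ^h, dθ) = wDensity γ α k x θ dθ` as `k → ∞`. -/
structure IsVagueLimit (γ α : ℝ) (x : Sample) (M : Measure ℝ) : Prop where
  compl_eq_zero : M (Set.Ioo 0 Real.pi)ᶜ = 0
  finite_of_isCompact : ∀ K : Set ℝ, IsCompact K → K ⊆ Set.Ioo 0 Real.pi → M K < ∞
  tendsto : ∀ f : ℝ → ℝ, Continuous f → HasCompactSupport f → tsupport f ⊆ Set.Ioo 0 Real.pi →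
    Tendsto (fun k : ℕ => ∫ θ in Set.Ioo 0 Real.pi, f θ * wDensity γ α k x θ) atTop
      (𝓝 (∫ θ, f θ ∂M))

open Classical in
/-- The chaos measure `V_α(φ^h, dθ)` on `(0, π)`: the vague limit of the measures
`W_α^{(k)}(φ^h, dθ)`, which is unique if it exists (and `0` at the sample points, if any, where
there is no vague limit). -/
def chaos (γ α : ℝ) (x : Sample) : Measure ℝ :=
  if h : ∃ M, IsVagueLimit γ α x M then h.choose else 0

/-- The total mass `V_α(φ^h) = sup_B V_α(φ^h, B)`, over the closed sets `B ⊆ (0, π)`. -/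
def chaosMass (γ α : ℝ) (x : Sample) : ℝ≥0∞ :=
  ⨆ (B : Set ℝ) (_ : IsClosed B) (_ : B ⊆ Set.Ioo 0 Real.pi), chaos γ α x B

/-- The exponent `p_2`. -/
def pTwo (γ α : ℝ) : ℝ :=
  1 / 2 * (1 - α / γ ^ 2) + Real.sqrt (1 / γ ^ 2 + 1 / 4 * (1 - α / γ ^ 2) ^ 2)

end HalfCircleGMC

end

noncomputable section

namespace HalfCircleGMC

open MeasureTheory ProbabilityTheory Filter Topology
open scoped ENNReal

/-! ### The Cameron–Martin formula -/

/-! For a fixed weight `g` dominated by `weight α` on `(0, π)`, the masses `massR γ g k` form a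
nonnegative martingale in `k` with constant mean `∫ g`, finite because `α < 1`; they therefore
converge almost surely. What remains is to show that no mass is lost in the limit, in particular
near the endpoints, and this follows from one uniform bound on moments of order `q > 1`.

The moment bound rests on the Cameron–Martin formula: weighting by the Wick exponential at `t`
amounts to translating the sample, and the translation multiplies the chaos density at `u` by `exp
(γ² cov k u t)` (`wickExp_add_wickShift`). The covariance is at most `log (1 / |u - t|)`, truncated
at `log k`, plus a boundary term of order `j log 2` when the points are at distance about `2 ^ (-j)`
from the endpoints. Moments of order `s < 1` of a set of size `2 ^ (-i)` come from Hölder's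
inequality with a tilt by the field at one point. Since `E[M^(q+1)] = ∫_S E[M(x + shift_t)^q] dt`, a
dyadic decomposition around `t` raises the order from `q` to `q + 1`. Induction gives the exponent
`q + γ² q (1 - q) / 2` for all noninteger orders `q < 2 / γ²`.

Cutting `(0, π)` into layers at distance about `2 ^ (-j)` from the boundary, the layer `j`
contributes at most `2 ^ (-j (1 - α p - γ² p (p - 1)))` to the moment of order `p`, up to constants.
The sum converges when `γ² p (p - 1) + α p < 1`, and `pTwo` is the positive root of the
corresponding equation.

A bound in `L^q` with `q > max p 1` gives uniform integrability, hence convergence in `L^p` and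
limits whose means are still `∫ g`. Increasing weights then have limit masses that increase to the
right limit, because their means do (`MassBound.ae_tendsto_limMass_of_monotone`). Applied to
compactly supported cutoffs, this identifies the total mass of the vague limit with the limit of
`wMass`; applied to the regularized weights, it gives the limit of `vMass` by a sandwich. The vague
limit itself comes from convergence against monomials, Weierstrass approximation and the
Riesz–Markov theorem. -/

instance : IsProbabilityMeasure gaussLaw := by unfold gaussLaw; infer_instance

lemma gaussianReal_withDensity_exp (a : ℝ) :
    (gaussianReal 0 1).withDensity (fun x => ENNReal.ofReal (Real.exp (a * x - a ^ 2 / 2))) =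
      gaussianReal a 1 := by
  rw [gaussianReal_of_var_ne_zero _ one_ne_zero, gaussianReal_of_var_ne_zero _ one_ne_zero,
    ← withDensity_mul _ (measurable_gaussianPDF _ _) (by fun_prop)]
  congr 1
  ext x
  simp only [Pi.mul_apply, gaussianPDF, gaussianPDFReal]
  rw [← ENNReal.ofReal_mul (by positivity), mul_assoc, ← Real.exp_add]
  congr 3
  simp
  ring

/-- Finite linear forms in the coordinates. -/
def linForm (k : ℕ) (c : ℕ → ℝ) (x : Sample) : ℝ := ∑ n ∈ Finset.range k, c n * x n.succPNat

/-- The vector with coordinates `c 0, …, c (k - 1), 0, 0, …`. -/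
def shift (k : ℕ) (c : ℕ → ℝ) : Sample := fun i => if i.natPred < k then c i.natPred else 0

@[fun_prop]
lemma measurable_linForm (k : ℕ) (c : ℕ → ℝ) : Measurable (linForm k c) := by
  unfold linForm; fun_prop

lemma linForm_add (k : ℕ) (c : ℕ → ℝ) (x y : Sample) :
    linForm k c (x + y) = linForm k c x + linForm k c y := by
  simp [linForm, mul_add, Finset.sum_add_distrib]

/-- The density factors over the coordinates, and each factor tilts a standard Gaussian into a
translated one. An infinite product measure is determined by its values on boxes, where independence
applies. -/
lemma withDensity_eq_map_shift (k : ℕ) (c : ℕ → ℝ) :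
    gaussLaw.withDensity
      (fun x => ENNReal.ofReal (Real.exp (linForm k c x - (∑ n ∈ Finset.range k, c n ^ 2) / 2))) =
      gaussLaw.map (fun x => x + shift k c) := by
  have hR : gaussLaw.map (fun x => x + shift k c) =
      Measure.infinitePi (fun i => gaussianReal (shift k c i) 1) := by
    have := Measure.infinitePi_map_pi (μ := fun _ : ℕ+ => gaussianReal 0 1)
      (f := fun i y => y + shift k c i) (fun i => by fun_prop)
    simp only [gaussianReal_map_add_const, zero_add] at this
    exact this
  rw [hR]
  apply Measure.eq_infinitePi
  intro s t ht
  classical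
  -- `F` carries the coordinates moved by the shift. The box over `s` is rewritten over `s ∪ F`,
  -- with full factors outside `s`, so that the box and the density involve the same coordinates.
  set F : Finset ℕ+ := (Finset.range k).image Nat.succPNat with hF
  have hsh : ∀ i, i ∉ F → shift k c i = 0 := by
    intro i hi
    unfold shift
    split_ifs with h
    · exact absurd (Finset.mem_image.2 ⟨i.natPred, Finset.mem_range.2 h, by simp⟩) hi
    · rfl
  have hsum : ∀ f : ℕ+ → ℝ, (∀ i, i ∉ F → f i = 0) →
      ∑ n ∈ Finset.range k, f n.succPNat = ∑ i ∈ s ∪ F, f i := by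
    intro f hf
    rw [← Finset.sum_subset (Finset.subset_union_right (s₁ := s) (s₂ := F))
      (fun i _ hi => hf i hi), hF, Finset.sum_image]
    intro a _ b _ hab
    exact Nat.succPNat_injective hab
  have hshn : ∀ n ∈ Finset.range k, shift k c n.succPNat = c n := by
    intro n hn
    simp [shift, Finset.mem_range.1 hn]
  set t' : ℕ+ → Set ℝ := fun i => if i ∈ s then t i else Set.univ with ht'
  have hmt' : ∀ i, MeasurableSet (t' i) := by
    intro i; simp only [ht']; split_ifs
    exacts [ht i, MeasurableSet.univ]
  have hset : Set.pi (↑s) t = Set.pi (↑(s ∪ F)) t' := by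
    ext x
    simp only [Set.mem_pi, ht', Finset.coe_union, Set.mem_union, Finset.mem_coe]
    constructor
    · intro h i _
      split_ifs with hi
      exacts [h i hi, trivial]
    · intro h i hi
      have := h i (Or.inl hi)
      simpa [hi] using this
  have hms : MeasurableSet (Set.pi (↑s) t : Set (ℕ+ → ℝ)) :=
    .pi s.countable_toSet fun _ _ => ht _
  rw [withDensity_apply _ hms, ← lintegral_indicator hms]
  have hpt : ∀ x : Sample, (Set.pi (↑s) t).indicator (fun x => ENNReal.ofReal
      (Real.exp (linForm k c x - (∑ n ∈ Finset.range k, c n ^ 2) / 2))) x =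
      ∏ i ∈ s ∪ F, ((t' i).indicator (fun y => ENNReal.ofReal
        (Real.exp (shift k c i * y - shift k c i ^ 2 / 2))) (x i)) := by
    intro x
    by_cases hx : x ∈ Set.pi (↑s) t
    · rw [Set.indicator_of_mem hx]
      rw [hset] at hx
      rw [Finset.prod_congr rfl (fun i hi => Set.indicator_of_mem (hx i hi) _),
        ← ENNReal.ofReal_prod_of_nonneg (fun _ _ => (Real.exp_pos _).le), ← Real.exp_sum]
      congr 2
      rw [← hsum _ (fun i hi => by simp [hsh i hi])]
      rw [linForm, Finset.sum_div, ← Finset.sum_sub_distrib]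
      refine Finset.sum_congr rfl fun n hn => ?_
      rw [hshn n hn]
    · rw [Set.indicator_of_notMem hx]
      rw [hset] at hx
      simp only [Set.mem_pi, not_forall] at hx
      obtain ⟨i, hi, hxi⟩ := hx
      exact (Finset.prod_eq_zero (Finset.mem_coe.1 hi) (Set.indicator_of_notMem hxi _)).symm
  simp_rw [hpt]
  have hind : iIndepFun (fun (i : ℕ+) (x : Sample) => (t' i).indicator (fun y => ENNReal.ofReal
        (Real.exp (shift k c i * y - shift k c i ^ 2 / 2))) (x i)) gaussLaw :=
    iIndepFun_infinitePi (P := fun _ : ℕ+ => gaussianReal 0 1)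
      (X := fun i y => (t' i).indicator (fun y => ENNReal.ofReal
        (Real.exp (shift k c i * y - shift k c i ^ 2 / 2))) y)
      (fun i => Measurable.indicator (by fun_prop) (hmt' i))
  have hmeas : ∀ i : ℕ+, Measurable (fun y : ℝ => (t' i).indicator (fun y => ENNReal.ofReal
        (Real.exp (shift k c i * y - shift k c i ^ 2 / 2))) y) :=
    fun i => Measurable.indicator (by fun_prop) (hmt' i)
  rw [lintegral_prod_eq_prod_lintegral_of_indepFun _ _ hind
    (fun i => (hmeas i).comp (measurable_pi_apply i))]
  have h1 : ∀ i : ℕ+, ∫⁻ x : Sample, (t' i).indicator (fun y => ENNReal.ofReal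
        (Real.exp (shift k c i * y - shift k c i ^ 2 / 2))) (x i) ∂gaussLaw =
        gaussianReal (shift k c i) 1 (t' i) := by
    intro i
    rw [← gaussianReal_withDensity_exp, withDensity_apply _ (hmt' i), ← lintegral_indicator (hmt' i)]
    exact (measurePreserving_eval_infinitePi (fun _ : ℕ+ => gaussianReal 0 1) i).lintegral_comp
      (hmeas i)
  simp_rw [h1]
  rw [← Finset.prod_subset (Finset.subset_union_left (s₁ := s) (s₂ := F))]
  · refine Finset.prod_congr rfl fun i hi => ?_
    simp [ht', hi]
  · intro i _ hi
    simp [ht', hi]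

/-- The Cameron–Martin formula for finitely supported shifts. -/
lemma lintegral_exp_linForm_mul (k : ℕ) (c : ℕ → ℝ) {F : Sample → ℝ≥0∞} (hF : Measurable F) :
    ∫⁻ x, ENNReal.ofReal (Real.exp (linForm k c x - (∑ n ∈ Finset.range k, c n ^ 2) / 2)) * F x
      ∂gaussLaw = ∫⁻ x, F (x + shift k c) ∂gaussLaw := by
  rw [← lintegral_map hF (by fun_prop), ← withDensity_eq_map_shift,
    lintegral_withDensity_eq_lintegral_mul _ (by fun_prop) hF]
  rfl

lemma lintegral_exp_linForm (k : ℕ) (c : ℕ → ℝ) :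
    ∫⁻ x, ENNReal.ofReal (Real.exp (linForm k c x)) ∂gaussLaw =
      ENNReal.ofReal (Real.exp ((∑ n ∈ Finset.range k, c n ^ 2) / 2)) := by
  have h := lintegral_exp_linForm_mul k c (F := fun _ =>
    ENNReal.ofReal (Real.exp ((∑ n ∈ Finset.range k, c n ^ 2) / 2))) measurable_const
  simp only [lintegral_const, measure_univ, mul_one] at h
  rw [← h]
  refine lintegral_congr fun x => ?_
  rw [← ENNReal.ofReal_mul (Real.exp_pos _).le, ← Real.exp_add]
  congr 2
  ring

/-! ### The field and its covariance -/

/-- The kernel `∑_{n=1}^k cos (n x) / n`. -/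
def cosKernel (k : ℕ) (x : ℝ) : ℝ :=
  ∑ n ∈ Finset.range k, Real.cos ((n + 1 : ℝ) * x) / (n + 1 : ℝ)

/-- The covariance of the truncated field. -/
def cov (k : ℕ) (t u : ℝ) : ℝ := cosKernel k (t - u) + cosKernel k (t + u)

/-- The coefficients of the field at the point `t`. -/
def fieldVec (t : ℝ) (n : ℕ) : ℝ :=
  Real.sqrt 2 / Real.sqrt (n + 1 : ℝ) * Real.cos ((n + 1 : ℝ) * t)

lemma field_eq_linForm (k : ℕ) (x : Sample) (t : ℝ) : field k x t = linForm k (fieldVec t) x := by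
  unfold field linForm fieldVec fourierCoeff
  refine Finset.sum_congr rfl fun n _ => ?_
  have : ((n.succPNat : ℕ) : ℝ) = (n : ℝ) + 1 := by simp
  rw [this]
  have h0 : Real.sqrt ((n : ℝ) + 1) ≠ 0 := by positivity
  field_simp

lemma sum_fieldVec_mul (k : ℕ) (t u : ℝ) :
    ∑ n ∈ Finset.range k, fieldVec t n * fieldVec u n = cov k t u := by
  unfold cov cosKernel fieldVec
  rw [← Finset.sum_add_distrib]
  refine Finset.sum_congr rfl fun n _ => ?_
  rw [mul_sub, mul_add, Real.cos_sub, Real.cos_add]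
  have h0 : (n : ℝ) + 1 ≠ 0 := by positivity
  have h1 : Real.sqrt ((n : ℝ) + 1) ^ 2 = (n : ℝ) + 1 := Real.sq_sqrt (by positivity)
  have h2 : Real.sqrt 2 ^ 2 = 2 := Real.sq_sqrt (by positivity)
  have h3 : Real.sqrt ((n : ℝ) + 1) ≠ 0 := by positivity
  calc _ = (Real.sqrt 2 ^ 2 / Real.sqrt ((n : ℝ) + 1) ^ 2) *
      (Real.cos ((n + 1) * t) * Real.cos ((n + 1) * u)) := by ring
    _ = _ := by rw [h1, h2]; ring

lemma linForm_shift (k m : ℕ) (hkm : k ≤ m) (c d : ℕ → ℝ) :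
    linForm k c (shift m d) = ∑ n ∈ Finset.range k, c n * d n := by
  unfold linForm shift
  refine Finset.sum_congr rfl fun n hn => ?_
  have := Finset.mem_range.1 hn
  simp [show n < m by omega]

lemma iIndepFun_coord : iIndepFun (fun (i : ℕ+) (x : Sample) => x i) gaussLaw :=
  iIndepFun_infinitePi (P := fun _ : ℕ+ => gaussianReal 0 1) (X := fun _ y => y)
    (fun _ => measurable_id)

lemma fieldVar_eq (k : ℕ) (t : ℝ) : fieldVar k t = cov k t t := by
  have hlaw : ∀ i : ℕ+, MeasurePreserving (fun x : Sample => x i) gaussLaw (gaussianReal 0 1) :=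
    fun i => measurePreserving_eval_infinitePi (fun _ : ℕ+ => gaussianReal 0 1) i
  have hmem : ∀ i : ℕ+, MemLp (fun x : Sample => x i) 2 gaussLaw := fun i =>
    (memLp_id_gaussianReal (μ := 0) (v := 1) 2).comp_measurePreserving (hlaw i)
  have hmean : ∀ i : ℕ+, ∫ x : Sample, x i ∂gaussLaw = 0 := by
    intro i
    have := (hlaw i).hasLaw.integral_eq
    simpa using this
  have hvar : ∀ i : ℕ+, variance (fun x : Sample => x i) gaussLaw = 1 := by
    intro i
    have := (hlaw i).hasLaw.variance_eq
    simpa using this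
  have h0 : ∫ x, linForm k (fieldVec t) x ∂gaussLaw = 0 := by
    unfold linForm
    rw [integral_finsetSum _ (fun n _ => ((hmem _).integrable one_le_two).const_mul _)]
    simp [integral_const_mul, hmean]
  have hv : variance (linForm k (fieldVec t)) gaussLaw = ∑ n ∈ Finset.range k, fieldVec t n ^ 2 := by
    have := IndepFun.variance_sum (μ := gaussLaw) (s := Finset.range k)
      (X := fun n x => fieldVec t n * x n.succPNat) (fun n _ => (hmem _).const_mul _)
      (fun i _ j _ hij => (iIndepFun_coord.indepFun
        (fun h => hij (Nat.succPNat_injective h))).comp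
        (measurable_const_mul (fieldVec t i)) (measurable_const_mul (fieldVec t j)))
    have h2 : linForm k (fieldVec t) = ∑ n ∈ Finset.range k, fun x : Sample =>
        fieldVec t n * x n.succPNat := by
      ext x; simp [linForm]
    rw [h2, this]
    refine Finset.sum_congr rfl fun n _ => ?_
    rw [variance_const_mul, hvar, mul_one]
  rw [variance_of_integral_eq_zero (by fun_prop) h0] at hv
  unfold fieldVar
  simp_rw [field_eq_linForm, hv, ← sum_fieldVec_mul, sq]

lemma continuous_cosKernel (k : ℕ) : Continuous (cosKernel k) := by
  unfold cosKernel; fun_prop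

@[fun_prop]
lemma continuous_fieldVar (k : ℕ) : Continuous (fieldVar k) := by
  have : fieldVar k = fun t => cosKernel k (t - t) + cosKernel k (t + t) := by
    ext t; rw [fieldVar_eq, cov]
  rw [this]
  have := continuous_cosKernel k
  fun_prop

lemma continuous_wickExp (γ : ℝ) (k : ℕ) (x : Sample) : Continuous (wickExp γ k x) := by
  unfold wickExp field; fun_prop

lemma measurable_wickExp_uncurry (γ : ℝ) (k : ℕ) :
    Measurable (fun z : Sample × ℝ => wickExp γ k z.1 z.2) := by
  have := (continuous_fieldVar k).measurable
  unfold wickExp field fourierCoeff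
  fun_prop

lemma wickExp_pos (γ : ℝ) (k : ℕ) (x : Sample) (t : ℝ) : 0 < wickExp γ k x t := Real.exp_pos _

/-- The shift of the sample produced by the Wick exponential at `t`. -/
def wickShift (γ : ℝ) (k : ℕ) (t : ℝ) : Sample := shift k (fun n => γ * fieldVec t n)

lemma linForm_const_mul (a : ℝ) (k : ℕ) (c : ℕ → ℝ) (x : Sample) :
    linForm k (fun n => a * c n) x = a * linForm k c x := by
  simp [linForm, Finset.mul_sum, mul_assoc]

lemma wickExp_eq (γ : ℝ) (k : ℕ) (x : Sample) (t : ℝ) :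
    wickExp γ k x t = Real.exp (linForm k (fun n => γ * fieldVec t n) x -
      (∑ n ∈ Finset.range k, (γ * fieldVec t n) ^ 2) / 2) := by
  rw [wickExp, linForm_const_mul, field_eq_linForm, fieldVar_eq, ← sum_fieldVec_mul]
  simp_rw [mul_pow, ← Finset.mul_sum, sq]
  congr 1
  ring

lemma lintegral_wickExp_mul (γ : ℝ) (k : ℕ) (t : ℝ) {F : Sample → ℝ≥0∞} (hF : Measurable F) :
    ∫⁻ x, ENNReal.ofReal (wickExp γ k x t) * F x ∂gaussLaw =
      ∫⁻ x, F (x + wickShift γ k t) ∂gaussLaw := by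
  simp_rw [wickExp_eq]
  exact lintegral_exp_linForm_mul k _ hF

/-- The translation moves the field at `u` by `γ cov k u t`. This factor is the source of all the
singular kernels in the moment estimates. -/
lemma wickExp_add_wickShift (γ : ℝ) (k : ℕ) (x : Sample) (t u : ℝ) :
    wickExp γ k (x + wickShift γ k t) u = Real.exp (γ ^ 2 * cov k u t) * wickExp γ k x u := by
  unfold wickExp wickShift
  rw [field_eq_linForm, field_eq_linForm, linForm_add, linForm_shift _ _ le_rfl, ← Real.exp_add,
    ← sum_fieldVec_mul]
  congr 1
  have : ∀ n, fieldVec u n * (γ * fieldVec t n) = γ * (fieldVec u n * fieldVec t n) :=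
    fun n => by ring
  simp_rw [this, ← Finset.mul_sum]
  ring

/-- The exponential moment used to compare the field at two points and two truncations. -/
lemma lintegral_wickExp_mul_exp (γ a : ℝ) (k m : ℕ) (hmk : m ≤ k) (t u : ℝ) :
    ∫⁻ x, ENNReal.ofReal (wickExp γ k x t) * ENNReal.ofReal (Real.exp (a * field m x u)) ∂gaussLaw =
      ENNReal.ofReal (Real.exp (a ^ 2 / 2 * cov m u u + a * γ * cov m u t)) := by
  have hm : Measurable fun x : Sample => ENNReal.ofReal (Real.exp (a * field m x u)) := by
    simp_rw [field_eq_linForm]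
    fun_prop
  rw [lintegral_wickExp_mul γ k t hm]
  have : ∀ x : Sample, ENNReal.ofReal (Real.exp (a * field m (x + wickShift γ k t) u)) =
      ENNReal.ofReal (Real.exp (a * γ * cov m u t)) *
        ENNReal.ofReal (Real.exp (linForm m (fun n => a * fieldVec u n) x)) := by
    intro x
    rw [field_eq_linForm, linForm_add, wickShift, linForm_shift _ _ hmk,
      ← ENNReal.ofReal_mul (Real.exp_pos _).le, ← Real.exp_add, linForm_const_mul,
      ← sum_fieldVec_mul]
    have : ∀ n, fieldVec u n * (γ * fieldVec t n) = γ * (fieldVec u n * fieldVec t n) :=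
      fun n => by ring
    simp_rw [this, ← Finset.mul_sum]
    congr 2
    ring
  simp_rw [this]
  rw [lintegral_const_mul _ (by fun_prop), lintegral_exp_linForm,
    ← ENNReal.ofReal_mul (Real.exp_pos _).le, ← Real.exp_add]
  congr 2
  rw [← sum_fieldVec_mul m u u]
  simp_rw [mul_pow, ← Finset.mul_sum, sq]
  ring

/-! ### Estimates on the kernel `∑_{n ≤ k} cos (n x) / n` -/

lemma cosKernel_succ (k : ℕ) (x : ℝ) :
    cosKernel (k + 1) x = cosKernel k x + Real.cos ((k + 1 : ℝ) * x) / (k + 1 : ℝ) := by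
  simp [cosKernel, Finset.sum_range_succ]

lemma harmonic_eq_sum (k : ℕ) : (harmonic k : ℝ) = ∑ n ∈ Finset.range k, 1 / (n + 1 : ℝ) := by
  simp [harmonic]

lemma cosKernel_le_one_add_log (k : ℕ) (x : ℝ) : cosKernel k x ≤ 1 + Real.log k := by
  refine le_trans ?_ (harmonic_le_one_add_log k)
  rw [harmonic_eq_sum]
  exact Finset.sum_le_sum fun n _ => div_le_div_of_nonneg_right (Real.cos_le_one _) (by positivity)

lemma log_le_cosKernel_zero (k : ℕ) (hk : 1 ≤ k) : Real.log k ≤ cosKernel k 0 := by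
  have h : cosKernel k 0 = (harmonic k : ℝ) := by
    rw [harmonic_eq_sum]; simp [cosKernel]
  rw [h]
  refine le_trans (Real.log_le_log (by positivity) ?_) (log_add_one_le_harmonic k)
  push_cast; linarith

lemma abs_cosKernel_sub_le_dist (k : ℕ) (x y : ℝ) :
    |cosKernel k x - cosKernel k y| ≤ k * |x - y| := by
  unfold cosKernel
  rw [← Finset.sum_sub_distrib]
  refine (Finset.abs_sum_le_sum_abs _ _).trans ?_
  refine (Finset.sum_le_card_nsmul _ _ |x - y| fun n _ => ?_).trans (by simp)
  have h0 : (0 : ℝ) < n + 1 := by positivity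
  rw [← sub_div, abs_div, abs_of_pos h0, div_le_iff₀ h0]
  have := Real.lipschitzWith_cos.dist_le_mul ((n + 1 : ℝ) * x) ((n + 1 : ℝ) * y)
  rw [Real.dist_eq, Real.dist_eq, ← mul_sub, abs_mul, abs_of_pos h0] at this
  simp at this
  linarith

lemma abs_sin_nat_mul_le (n : ℕ) (y : ℝ) : |Real.sin (n * y)| ≤ n * |Real.sin y| := by
  induction n with
  | zero => simp
  | succ n ih =>
    push_cast
    rw [add_mul, one_mul, Real.sin_add]
    calc _ ≤ |Real.sin (n * y)| * |Real.cos y| + |Real.cos (n * y)| * |Real.sin y| := by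
          rw [← abs_mul, ← abs_mul]; exact abs_add_le _ _
      _ ≤ |Real.sin (n * y)| * 1 + 1 * |Real.sin y| := by
          gcongr <;> exact Real.abs_cos_le_one _
      _ ≤ _ := by linarith

/-- Summation by parts: the tail of the cosine series. -/
lemma abs_cosKernel_sub_le_tail {m k : ℕ} (hmk : m ≤ k) (x : ℝ) (hx : 0 < |Real.sin (x / 2)|) :
    |cosKernel k x - cosKernel m x| ≤ 1 / ((m + 1) * |Real.sin (x / 2)|) := by
  set s : ℕ → ℝ := fun j => Real.sin ((j + 1 / 2 : ℝ) * x) with hs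
  -- Since `2 sin (x/2) cos ((j+1) x) = s (j+1) - s j`, subtracting `s j / (j+1)` leaves increments
  -- `s (j+1) (1/(j+1) - 1/(j+2))`, whose absolute values are bounded by a telescoping sum.
  set A : ℕ → ℝ := fun j => 2 * Real.sin (x / 2) * cosKernel j x - s j / (j + 1) with hA
  have hs1 : ∀ j, |s j| ≤ 1 := fun j => Real.abs_sin_le_one _
  have hstep : ∀ j : ℕ, A (j + 1) - A j = s (j + 1) * (1 / (j + 1) - 1 / (j + 2)) := by
    intro j
    have h1 : 2 * Real.sin (x / 2) * Real.cos ((j + 1 : ℝ) * x) = s (j + 1) - s j := by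
      simp only [hs]
      push_cast
      rw [show ((j : ℝ) + 1 + 1 / 2) * x = (j + 1) * x + x / 2 by ring,
        show ((j : ℝ) + 1 / 2) * x = (j + 1) * x - x / 2 by ring, Real.sin_add, Real.sin_sub]
      ring
    simp only [hA]
    rw [cosKernel_succ, mul_add, ← mul_div_assoc, h1]
    push_cast
    have h2 : (j : ℝ) + 1 ≠ 0 := by positivity
    have h3 : (j : ℝ) + 2 ≠ 0 := by positivity
    have h4 : (j : ℝ) + 1 + 1 ≠ 0 := by positivity
    field_simp
    ring
  have hind : |A k - A m| ≤ 1 / (m + 1) - 1 / (k + 1) := by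
    induction k, hmk using Nat.le_induction with
    | base => simp
    | succ k hmk ih =>
      have h1 : |A (k + 1) - A k| ≤ 1 / (k + 1) - 1 / (k + 2) := by
        rw [hstep, abs_mul]
        have h2 : (0 : ℝ) ≤ 1 / (k + 1) - 1 / (k + 2) := by
          rw [sub_nonneg]
          exact one_div_le_one_div_of_le (by positivity) (by linarith)
        rw [abs_of_nonneg h2]
        exact mul_le_of_le_one_left h2 (hs1 _)
      have h3 : |A (k + 1) - A m| ≤ |A (k + 1) - A k| + |A k - A m| := abs_sub_le _ _ _
      have h4 : ((k + 1 : ℕ) : ℝ) + 1 = k + 2 := by push_cast; ring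
      rw [h4]
      linarith
  have hb : ∀ j : ℕ, |s j / (j + 1)| ≤ 1 / (j + 1) := by
    intro j
    rw [abs_div, abs_of_pos (show (0 : ℝ) < j + 1 by positivity)]
    exact div_le_div_of_nonneg_right (hs1 j) (by positivity)
  have hfin : |2 * Real.sin (x / 2) * (cosKernel k x - cosKernel m x)| ≤ 2 / (m + 1) := by
    have h1 : 2 * Real.sin (x / 2) * (cosKernel k x - cosKernel m x) =
        (A k - A m) + s k / (k + 1) - s m / (m + 1) := by
      simp only [hA]; ring
    rw [h1]
    have h2 := abs_sub (A k - A m + s k / (k + 1)) (s m / (m + 1))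
    have h3 := abs_add_le (A k - A m) (s k / (k + 1))
    have h4 := hb k
    have h5 := hb m
    have h6 : (2 : ℝ) / (m + 1) = 1 / (m + 1) + 1 / (m + 1) := by ring
    linarith
  rw [abs_mul, abs_mul, abs_two] at hfin
  have h0 : (0 : ℝ) < m + 1 := by positivity
  rw [le_div_iff₀ (by positivity)]
  rw [le_div_iff₀ h0] at hfin
  linarith

/-- The sum is cut at `m = ⌊1/u⌋` with `u = |sin (x/2)|`: up to `m` the harmonic bound gives `1 -
log u`, and beyond `m` oscillation makes the tail at most `1 / ((m+1) u) ≤ 1`. -/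
lemma cosKernel_le_sub_log (k : ℕ) (x : ℝ) (hx : 0 < |Real.sin (x / 2)|) :
    cosKernel k x ≤ 2 - Real.log |Real.sin (x / 2)| := by
  set u := |Real.sin (x / 2)| with hu
  have hu1 : u ≤ 1 := Real.abs_sin_le_one _
  have hlog : Real.log u ≤ 0 := Real.log_nonpos hx.le hu1
  have hsmall : ∀ n : ℕ, (n : ℝ) ≤ 1 / u → cosKernel n x ≤ 1 - Real.log u := by
    intro n hn
    rcases Nat.eq_zero_or_pos n with rfl | hn0
    · simp [cosKernel]; linarith
    · have h1 := cosKernel_le_one_add_log n x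
      have h2 : Real.log n ≤ Real.log (1 / u) := Real.log_le_log (by exact_mod_cast hn0) hn
      rw [one_div, Real.log_inv] at h2
      linarith
  set m := ⌊1 / u⌋₊ with hm
  have hm1 : (m : ℝ) ≤ 1 / u := Nat.floor_le (by positivity)
  have hm2 : 1 / u < m + 1 := Nat.lt_floor_add_one _
  rcases le_total k m with hkm | hkm
  · have := hsmall k (le_trans (by exact_mod_cast hkm) hm1)
    linarith
  · have h1 := (abs_le.1 (abs_cosKernel_sub_le_tail hkm x hx)).2
    have h2 : 1 / ((m + 1) * u) ≤ 1 := by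
      rw [div_le_one (by positivity)]
      rw [div_lt_iff₀ hx] at hm2
      exact hm2.le
    have h3 := hsmall m hm1
    linarith

/-- The same cut at `⌊1/u⌋`: before it each term is at least `-2u`, because `cos (n x) ≥ 1 - 2 n u`,
for a total of at least `-2`; the tail costs at most `1`. The bound makes the variance at least `log
k - 3`, even close to the boundary. -/
lemma neg_three_le_cosKernel (k : ℕ) (x : ℝ) : -3 ≤ cosKernel k x := by
  set u := |Real.sin (x / 2)| with hu
  have hu0 : 0 ≤ u := abs_nonneg _
  have hsmall : ∀ n : ℕ, -(2 * n * u) ≤ cosKernel n x := by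
    intro n
    unfold cosKernel
    have : -(2 * n * u) = ∑ i ∈ Finset.range n, -(2 * u) := by simp; ring
    rw [this]
    refine Finset.sum_le_sum fun i _ => ?_
    have h0 : (0 : ℝ) < i + 1 := by positivity
    rw [le_div_iff₀ h0]
    have h1 := abs_sin_nat_mul_le (i + 1) (x / 2)
    push_cast at h1
    have h2 : Real.cos ((i + 1 : ℝ) * x) = 1 - 2 * Real.sin ((i + 1 : ℝ) * (x / 2)) ^ 2 := by
      rw [show (i + 1 : ℝ) * x = 2 * ((i + 1 : ℝ) * (x / 2)) by ring, Real.cos_two_mul,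
        Real.cos_sq']
      ring
    have h3 : Real.sin ((i + 1 : ℝ) * (x / 2)) ^ 2 ≤ |Real.sin ((i + 1 : ℝ) * (x / 2))| := by
      rw [← sq_abs]
      have := Real.abs_sin_le_one ((i + 1 : ℝ) * (x / 2))
      nlinarith [abs_nonneg (Real.sin ((i + 1 : ℝ) * (x / 2)))]
    rw [h2]
    nlinarith
  rcases hu0.eq_or_lt with h0 | h0
  · have := hsmall k
    rw [← h0] at this
    linarith
  · set m := ⌊1 / u⌋₊ with hm
    have hm1 : (m : ℝ) ≤ 1 / u := Nat.floor_le (by positivity)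
    have hm2 : 1 / u < m + 1 := Nat.lt_floor_add_one _
    rw [le_div_iff₀ h0] at hm1
    rcases le_total k m with hkm | hkm
    · have h1 := hsmall k
      have h2 : (k : ℝ) * u ≤ m * u := by gcongr
      linarith
    · have h1 := (abs_le.1 (abs_cosKernel_sub_le_tail hkm x h0)).1
      have h2 : 1 / ((m + 1) * u) ≤ 1 := by
        rw [div_le_one (by positivity)]
        rw [div_lt_iff₀ h0] at hm2
        exact hm2.le
      have h3 := hsmall m
      linarith

lemma cov_self_ge (k : ℕ) (hk : 1 ≤ k) (t : ℝ) : Real.log k - 3 ≤ cov k t t := by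
  have h1 := log_le_cosKernel_zero k hk
  have h2 := neg_three_le_cosKernel k (t + t)
  rw [cov, sub_self]
  linarith

/-- Each `cos (n x) / n` is 1-Lipschitz. Hence at scale `1 / k` the covariance of the field
truncated at `k` varies by a bounded amount only. -/
lemma abs_cov_sub_le (k : ℕ) (t u : ℝ) : |cov k u t - cov k u u| ≤ 2 * k * |t - u| := by
  have h1 := abs_cosKernel_sub_le_dist k (u - t) (u - u)
  have h2 := abs_cosKernel_sub_le_dist k (u + t) (u + u)
  rw [show u - t - (u - u) = -(t - u) by ring, abs_neg] at h1
  rw [show u + t - (u + u) = t - u by ring] at h2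
  have h3 := abs_add_le (cosKernel k (u - t) - cosKernel k (u - u))
    (cosKernel k (u + t) - cosKernel k (u + u))
  unfold cov
  calc _ = |cosKernel k (u - t) - cosKernel k (u - u) +
        (cosKernel k (u + t) - cosKernel k (u + u))| := by congr 1; ring
    _ ≤ _ := by linarith

/-- The points of `(0, π)` at distance of order at least `2 ^ (-j)` from the boundary. -/
def inner (j : ℕ) : Set ℝ := {t | t ∈ Set.Ioo 0 Real.pi ∧ (1 / 2 : ℝ) ^ (j + 1) < Real.sin t}

/-- Concavity of the sine keeps `(t + u) / 2` as far from the boundary as `t` and `u`. This bounds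
the part of the covariance due to reflection, and is the only source of the dependence on `j`. -/
lemma cosKernel_add_le {j : ℕ} {t u : ℝ} (ht : t ∈ inner j) (hu : u ∈ inner j) (k : ℕ) :
    cosKernel k (t + u) ≤ 2 + (j + 2) * Real.log 2 := by
  obtain ⟨⟨t0, t1⟩, t2⟩ := ht
  obtain ⟨⟨u0, u1⟩, u2⟩ := hu
  have h1 : (1 / 2 : ℝ) * Real.sin t + (1 / 2) * Real.sin u ≤
      Real.sin ((1 / 2) * t + (1 / 2) * u) := by
    have hc := strictConcaveOn_sin_Icc.concaveOn
    have := hc.2 (⟨t0.le, t1.le⟩ : t ∈ Set.Icc 0 Real.pi) (⟨u0.le, u1.le⟩ : u ∈ Set.Icc 0 Real.pi)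
      (show (0 : ℝ) ≤ 1 / 2 by norm_num) (show (0 : ℝ) ≤ 1 / 2 by norm_num) (by norm_num)
    simpa using this
  have hp : (0 : ℝ) < (1 / 2) ^ (j + 1) := by positivity
  have h2 : (1 / 2 : ℝ) ^ (j + 2) ≤ Real.sin ((t + u) / 2) := by
    rw [show (t + u) / 2 = (1 / 2) * t + (1 / 2) * u by ring, pow_succ]
    linarith
  have h3 : (0 : ℝ) < (1 / 2) ^ (j + 2) := by positivity
  have h4 : |Real.sin ((t + u) / 2)| = Real.sin ((t + u) / 2) := abs_of_pos (h3.trans_le h2)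
  have h5 := cosKernel_le_sub_log k (t + u) (by rw [h4]; exact h3.trans_le h2)
  have h6 := Real.log_le_log h3 h2
  rw [h4] at h5
  rw [Real.log_pow, one_div, Real.log_inv] at h6
  push_cast at h6
  linarith

/-- The logarithmic upper bound for the covariance, in dyadic form. -/
lemma exists_cov_le {R : ℝ} (hR : 0 < R) : ∃ C : ℝ, ∀ (k i j : ℕ) (t u : ℝ), 2 ^ i ≤ k →
    t ∈ inner j → u ∈ inner j → |u - t| ≤ R * (1 / 2) ^ i →
    ∃ l : ℕ, 2 ^ (i + l) ≤ k ∧ |u - t| ≤ R * (1 / 2) ^ (i + l) ∧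
      cov k u t ≤ C + (i + l + j) * Real.log 2 := by
  refine ⟨4 + |Real.log (Real.pi / R)| + 3 * Real.log 2, fun k i j t u hk ht hu htu => ?_⟩
  classical
  -- The witness is the last `l` before one of the two conditions fails. At `l + 1` either `k < 2 ^
  -- (i+l+1)`, and the harmonic bound applies, or `|u - t| > R 2 ^ (-(i+l+1))`, and the logarithmic
  -- bound does.
  have hex : ∃ l : ℕ, ¬ (2 ^ (i + l) ≤ k ∧ |u - t| ≤ R * (1 / 2) ^ (i + l)) := by
    refine ⟨k, fun h => ?_⟩
    have h1 : k < 2 ^ k := Nat.lt_two_pow_self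
    have h2 : 2 ^ k ≤ 2 ^ (i + k) := Nat.pow_le_pow_right (by norm_num) (by omega)
    omega
  set L := Nat.find hex with hL
  have hL0 : L ≠ 0 := by
    intro h0
    have := Nat.find_spec hex
    rw [← hL, h0] at this
    exact this ⟨by simpa using hk, by simpa using htu⟩
  obtain ⟨l, hl⟩ := Nat.exists_eq_succ_of_ne_zero hL0
  have hlt : l < L := by omega
  have hgood := not_not.1 (Nat.find_min hex hlt)
  have hbad := Nat.find_spec hex
  rw [← hL, hl] at hbad
  refine ⟨l, hgood.1, hgood.2, ?_⟩
  have h1 := cosKernel_add_le hu ht k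
  have habs := abs_nonneg (Real.log (Real.pi / R))
  have hlog2 : 0 < Real.log 2 := Real.log_pos (by norm_num)
  have h2 : cosKernel k (u - t) ≤ 2 + |Real.log (Real.pi / R)| + (i + l + 1) * Real.log 2 := by
    rcases not_and_or.1 hbad with h | h
    · have h3 := cosKernel_le_one_add_log k (u - t)
      have hk0 : 0 < k := lt_of_lt_of_le (by positivity) hk
      have h4 : Real.log k ≤ Real.log ((2 : ℝ) ^ (i + (l + 1))) :=
        Real.log_le_log (by exact_mod_cast hk0) (by exact_mod_cast (not_le.1 h).le)
      rw [Real.log_pow] at h4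
      push_cast at h4
      linarith
    · have h := not_le.1 h
      have hpos : 0 < R * (1 / 2 : ℝ) ^ (i + (l + 1)) := by positivity
      have hut : |u - t| < Real.pi := by
        rw [abs_lt]
        constructor <;> linarith [ht.1.1, ht.1.2, hu.1.1, hu.1.2]
      have h3 : |u - t| / Real.pi ≤ |Real.sin ((u - t) / 2)| := by
        have := Real.mul_abs_le_abs_sin (x := (u - t) / 2) (by
          rw [abs_div, abs_two]; linarith)
        rw [abs_div, abs_two] at this
        calc _ = 2 / Real.pi * (|u - t| / 2) := by ring
          _ ≤ _ := this
      have h4 : R / Real.pi * (1 / 2 : ℝ) ^ (i + (l + 1)) ≤ |Real.sin ((u - t) / 2)| := by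
        refine le_trans ?_ h3
        rw [div_mul_eq_mul_div]
        exact div_le_div_of_nonneg_right h.le Real.pi_pos.le
      have hpos2 : 0 < R / Real.pi * (1 / 2 : ℝ) ^ (i + (l + 1)) := by
        have := Real.pi_pos; positivity
      have h5 := cosKernel_le_sub_log k (u - t) (hpos2.trans_le h4)
      have h6 := Real.log_le_log hpos2 h4
      rw [Real.log_mul (div_pos hR Real.pi_pos).ne' (by positivity), Real.log_pow, one_div,
        Real.log_inv, ← inv_div, Real.log_inv] at h6
      have h7 := le_abs_self (Real.log (Real.pi / R))
      push_cast at h6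
      linarith
  unfold cov
  linarith

/-! ### Powers of two in `ℝ≥0∞` and sums of dyadic sequences -/

lemma ofReal_exp_mul_log_two (r : ℝ) :
    ENNReal.ofReal (Real.exp (r * Real.log 2)) = (2 : ℝ≥0∞) ^ r := by
  rw [mul_comm, ← Real.rpow_def_of_pos two_pos, ← ENNReal.ofReal_rpow_of_pos two_pos]
  norm_num

lemma two_rpow_add (a b : ℝ) : (2 : ℝ≥0∞) ^ (a + b) = 2 ^ a * 2 ^ b :=
  ENNReal.rpow_add _ _ two_ne_zero (by norm_num)

lemma ofReal_half_pow (i : ℕ) : ENNReal.ofReal ((1 / 2 : ℝ) ^ i) = 2 ^ (-(i : ℝ)) := by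
  rw [← ofReal_exp_mul_log_two, ← Real.exp_log (show (0 : ℝ) < (1 / 2) ^ i by positivity),
    Real.log_pow, one_div, Real.log_inv]
  congr 2; ring

lemma tsum_two_rpow_neg_ne_top {ε : ℝ} (hε : 0 < ε) :
    ∑' t : ℕ, (2 : ℝ≥0∞) ^ (-(ε * t)) ≠ ⊤ := by
  have h : ∀ t : ℕ, (2 : ℝ≥0∞) ^ (-(ε * t)) = ((2 : ℝ≥0∞) ^ (-ε)) ^ t := by
    intro t
    rw [← ENNReal.rpow_natCast, ← ENNReal.rpow_mul]
    congr 1; ring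
  simp_rw [h]
  rw [ENNReal.tsum_geometric]
  apply ENNReal.inv_ne_top.2
  have : (2 : ℝ≥0∞) ^ (-ε) < 1 := ENNReal.rpow_lt_one_of_one_lt_of_neg (by norm_num) (by linarith)
  exact (tsub_pos_of_lt this).ne'

/-- Each `a t` is at most `2 ^ (-δ t / q)` times the `1/q`-th power of the right-hand sum, and these
factors are summable. It serves for all `q > 0`, in place of the triangle inequality for `q ≥ 1` and
of subadditivity for `q < 1`, at the price of an arbitrarily small geometric loss. -/
lemma exists_tsum_rpow_le {q δ : ℝ} (hq : 0 < q) (hδ : 0 < δ) :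
    ∃ C : ℝ≥0∞, C ≠ ⊤ ∧ ∀ a : ℕ → ℝ≥0∞,
      (∑' t, a t) ^ q ≤ C * ∑' t : ℕ, 2 ^ (δ * t) * a t ^ q := by
  refine ⟨(∑' t : ℕ, (2 : ℝ≥0∞) ^ (-(δ / q * t))) ^ q,
    ENNReal.rpow_ne_top_of_nonneg hq.le (tsum_two_rpow_neg_ne_top (by positivity)), fun a => ?_⟩
  set B := ∑' t : ℕ, (2 : ℝ≥0∞) ^ (δ * t) * a t ^ q with hB
  have h1 : ∀ t, a t ≤ 2 ^ (-(δ / q * t)) * B ^ (1 / q) := by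
    intro t
    have h2 : (2 : ℝ≥0∞) ^ (δ * t) * a t ^ q ≤ B :=
      ENNReal.le_tsum (f := fun t : ℕ => (2 : ℝ≥0∞) ^ (δ * t) * a t ^ q) t
    have h3 := ENNReal.rpow_le_rpow h2 (show 0 ≤ 1 / q by positivity)
    rw [ENNReal.mul_rpow_of_nonneg _ _ (by positivity), ← ENNReal.rpow_mul, ← ENNReal.rpow_mul,
      mul_one_div_cancel hq.ne', ENNReal.rpow_one] at h3
    calc a t = 2 ^ (-(δ / q * t)) * (2 ^ (δ * t * (1 / q)) * a t) := by
          rw [← mul_assoc, ← two_rpow_add]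
          rw [show -(δ / q * t) + δ * t * (1 / q) = 0 by ring]
          simp
      _ ≤ _ := by gcongr
  calc (∑' t, a t) ^ q ≤ (∑' t : ℕ, 2 ^ (-(δ / q * t)) * B ^ (1 / q)) ^ q :=
        ENNReal.rpow_le_rpow (ENNReal.tsum_le_tsum h1) hq.le
    _ = _ := by
        rw [ENNReal.tsum_mul_right, ENNReal.mul_rpow_of_nonneg _ _ hq.le, ← ENNReal.rpow_mul,
          one_div_mul_cancel hq.ne', ENNReal.rpow_one]

/-! ### Moments of the chaos of small sets -/

/-- The unweighted approximate chaos measure of a set. -/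
def gmcMass (γ : ℝ) (k : ℕ) (S : Set ℝ) (x : Sample) : ℝ≥0∞ :=
  ∫⁻ t in S, ENNReal.ofReal (wickExp γ k x t)

@[fun_prop]
lemma measurable_gmcMass (γ : ℝ) (k : ℕ) (S : Set ℝ) : Measurable (gmcMass γ k S) := by
  have h := (measurable_wickExp_uncurry γ k).ennreal_ofReal
  unfold gmcMass
  exact Measurable.lintegral_prod_right' (ν := volume.restrict S) h

lemma measurable_wickExp_right (γ : ℝ) (k : ℕ) (x : Sample) : Measurable (wickExp γ k x) :=
  (continuous_wickExp γ k x).measurable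

lemma lintegral_gmcMass_mul (γ : ℝ) (k : ℕ) (S : Set ℝ) {F : Sample → ℝ≥0∞} (hF : Measurable F) :
    ∫⁻ x, gmcMass γ k S x * F x ∂gaussLaw =
      ∫⁻ t in S, ∫⁻ x, ENNReal.ofReal (wickExp γ k x t) * F x ∂gaussLaw := by
  have h : ∀ x, gmcMass γ k S x * F x = ∫⁻ t in S, ENNReal.ofReal (wickExp γ k x t) * F x :=
    fun x => (lintegral_mul_const _ (measurable_wickExp_right γ k x).ennreal_ofReal).symm
  simp_rw [h]
  refine lintegral_lintegral_swap (Measurable.aemeasurable ?_)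
  exact (measurable_wickExp_uncurry γ k).ennreal_ofReal.mul (hF.comp measurable_fst)

lemma volume_le_of_subset_closedBall {S : Set ℝ} {c R : ℝ} (hR : 0 < R) (i : ℕ)
    (hS : S ⊆ Metric.closedBall c (R * (1 / 2) ^ i)) :
    volume S ≤ ENNReal.ofReal (2 * R) * 2 ^ (-(i : ℝ)) := by
  refine (measure_mono hS).trans ?_
  rw [Real.volume_closedBall, ← mul_assoc, ENNReal.ofReal_mul (by positivity), ofReal_half_pow]

/-- `MomentBound γ q ξ e`: moments of order `q` of the chaos of sets of diameter `2 ^ (-i)` at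
distance `2 ^ (-j)` from the boundary are of order `2 ^ (-i ξ + j e)`. -/
def MomentBound (γ q ξ e : ℝ) : Prop :=
  ∀ R : ℝ, 0 < R → ∃ C : ℝ≥0∞, C ≠ ⊤ ∧ ∀ (k i j : ℕ) (c : ℝ) (S : Set ℝ), 2 ^ i ≤ k →
    MeasurableSet S → S ⊆ inner j → S ⊆ Metric.closedBall c (R * (1 / 2) ^ i) →
    ∫⁻ x, gmcMass γ k S x ^ q ∂gaussLaw ≤ C * 2 ^ (-(i * ξ) + j * e)

lemma lintegral_exp_field (a : ℝ) (m : ℕ) (u : ℝ) :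
    ∫⁻ x, ENNReal.ofReal (Real.exp (a * field m x u)) ∂gaussLaw =
      ENNReal.ofReal (Real.exp (a ^ 2 / 2 * cov m u u)) := by
  have h := lintegral_wickExp_mul_exp 0 a m m le_rfl u u
  simpa [wickExp] using h

/-- Moments of order `s < 1`. -/
lemma momentBound_of_lt_one (γ s : ℝ) (hγ : 0 < γ) (hs0 : 0 < s) (hs1 : s < 1) :
    MomentBound γ s (s + γ ^ 2 * (s * (1 - s)) / 2) 0 := by
  intro R hR
  -- With `X` the field at `c` truncated at `2 ^ i`, Hölder gives `E[M^s] ≤ E[M e^(-bX)]^s E[e^(γ s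
  -- X)]^(1-s)`. This `b` minimizes the exponent among such tilts and yields `-γ² s (1-s) / 2` times
  -- the variance of `X`.
  set b := (1 - s) * γ with hb
  have hb0 : 0 < b := mul_pos (by linarith) hγ
  set A := 3 * (γ ^ 2 * (s * (1 - s)) / 2) + s * (b * γ * (2 * R)) with hA
  refine ⟨ENNReal.ofReal (2 * R) ^ s * ENNReal.ofReal (Real.exp A),
    ENNReal.mul_ne_top (ENNReal.rpow_ne_top_of_nonneg hs0.le ENNReal.ofReal_ne_top)
      ENNReal.ofReal_ne_top, fun k i j c S hik hS _ hSc => ?_⟩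
  set m : ℕ := 2 ^ i with hm
  set V := cov m c c with hV
  have hX : ∀ a : ℝ, Measurable (fun x => ENNReal.ofReal (Real.exp (a * field m x c))) := by
    intro a
    simp_rw [field_eq_linForm]
    fun_prop
  have h1 : ∀ x, gmcMass γ k S x ^ s =
      (gmcMass γ k S x * ENNReal.ofReal (Real.exp (-b * field m x c))) ^ s *
        ENNReal.ofReal (Real.exp ((γ * s) * field m x c)) ^ (1 - s) := by
    intro x
    rw [ENNReal.mul_rpow_of_nonneg _ _ hs0.le, mul_assoc,
      ENNReal.ofReal_rpow_of_pos (Real.exp_pos _), ENNReal.ofReal_rpow_of_pos (Real.exp_pos _),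
      ← Real.exp_mul, ← Real.exp_mul, ← ENNReal.ofReal_mul (Real.exp_pos _).le, ← Real.exp_add]
    rw [show -b * field m x c * s + γ * s * field m x c * (1 - s) = 0 by rw [hb]; ring]
    simp
  simp_rw [h1]
  refine (ENNReal.lintegral_mul_norm_pow_le (by fun_prop) (hX _).aemeasurable hs0.le
    (by linarith) (by ring)).trans ?_
  rw [lintegral_gmcMass_mul _ _ _ (hX _), lintegral_exp_field]
  have h2 : ∫⁻ t in S, ∫⁻ x, ENNReal.ofReal (wickExp γ k x t) *
      ENNReal.ofReal (Real.exp (-b * field m x c)) ∂gaussLaw ≤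
      ENNReal.ofReal (Real.exp (b ^ 2 / 2 * V - b * γ * V + b * γ * (2 * R))) *
        (ENNReal.ofReal (2 * R) * 2 ^ (-(i : ℝ))) := by
    calc _ ≤ ∫⁻ t in S, ENNReal.ofReal
          (Real.exp (b ^ 2 / 2 * V - b * γ * V + b * γ * (2 * R))) := by
          refine setLIntegral_mono measurable_const fun t ht => ?_
          rw [lintegral_wickExp_mul_exp γ (-b) k m hik t c]
          refine ENNReal.ofReal_le_ofReal (Real.exp_le_exp.2 ?_)
          have h3 := abs_cov_sub_le m t c
          have h4 := hSc ht
          rw [Metric.mem_closedBall, Real.dist_eq] at h4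
          have h5 : 2 * (m : ℝ) * |t - c| ≤ 2 * R := by
            have h6 : (m : ℝ) * (1 / 2) ^ i = 1 := by
              rw [hm]; push_cast; rw [← mul_pow]; norm_num
            have h7 : (m : ℝ) * |t - c| ≤ m * (R * (1 / 2) ^ i) := by gcongr
            have h8 : (m : ℝ) * (R * (1 / 2) ^ i) = R * (m * (1 / 2) ^ i) := by ring
            rw [h8, h6] at h7
            linarith
          have h6 := (abs_le.1 (h3.trans h5)).1
          rw [← hV] at h6 ⊢
          have h7 : 0 < b * γ := by positivity
          nlinarith
      _ = ENNReal.ofReal (Real.exp (b ^ 2 / 2 * V - b * γ * V + b * γ * (2 * R))) * volume S := by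
          rw [setLIntegral_const]
      _ ≤ _ := by gcongr; exact volume_le_of_subset_closedBall hR i hSc
  -- The variance enters with a negative coefficient, so a lower bound is what is needed.
  have hlogm : (i : ℝ) * Real.log 2 - 3 ≤ V := by
    have := cov_self_ge m Nat.one_le_two_pow c
    rw [hm] at this
    push_cast at this
    rwa [Real.log_pow] at this
  calc _ ≤ (ENNReal.ofReal (Real.exp (b ^ 2 / 2 * V - b * γ * V + b * γ * (2 * R))) *
        (ENNReal.ofReal (2 * R) * 2 ^ (-(i : ℝ)))) ^ s *
        ENNReal.ofReal (Real.exp ((γ * s) ^ 2 / 2 * V)) ^ (1 - s) := by gcongr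
    _ = ENNReal.ofReal (2 * R) ^ s * 2 ^ (-(i : ℝ) * s) *
        ENNReal.ofReal (Real.exp (-(γ ^ 2 * (s * (1 - s)) / 2) * V + s * (b * γ * (2 * R)))) := by
        rw [ENNReal.mul_rpow_of_nonneg _ _ hs0.le, ENNReal.mul_rpow_of_nonneg _ _ hs0.le,
          ← ENNReal.rpow_mul, ENNReal.ofReal_rpow_of_pos (Real.exp_pos _),
          ENNReal.ofReal_rpow_of_pos (Real.exp_pos _), ← Real.exp_mul, ← Real.exp_mul]
        have : ∀ a b c d : ℝ≥0∞, a * (b * c) * d = b * c * (a * d) := fun a b c d => by ring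
        rw [this, ← ENNReal.ofReal_mul (Real.exp_pos _).le, ← Real.exp_add]
        congr 3
        rw [hb]
        ring
    _ ≤ ENNReal.ofReal (2 * R) ^ s * 2 ^ (-(i : ℝ) * s) *
        ENNReal.ofReal (Real.exp (A + (-(γ ^ 2 * (s * (1 - s)) / 2) * i) * Real.log 2)) := by
        refine mul_le_mul' le_rfl (ENNReal.ofReal_le_ofReal (Real.exp_le_exp.2 ?_))
        have : 0 ≤ γ ^ 2 * (s * (1 - s)) / 2 := by
          have : 0 < 1 - s := by linarith
          positivity
        rw [hA]
        nlinarith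
    _ = _ := by
        rw [Real.exp_add, ENNReal.ofReal_mul (Real.exp_pos _).le, ofReal_exp_mul_log_two,
          show -((i : ℝ) * (s + γ ^ 2 * (s * (1 - s)) / 2)) + j * 0 =
            -(i : ℝ) * s + -(γ ^ 2 * (s * (1 - s)) / 2) * i by ring, two_rpow_add]
        ring

/-- From moments of order `q` to moments of order `q + 1`. -/
lemma MomentBound.lintegral_rpow_add_one_le {γ q ξ e : ℝ} (h : MomentBound γ q ξ e) (hq : 0 < q)
    (hξ : γ ^ 2 * q < ξ) {R : ℝ} (hR : 0 < R) :
    ∃ C : ℝ≥0∞, C ≠ ⊤ ∧ ∀ (k i j : ℕ) (c : ℝ) (S : Set ℝ), 2 ^ i ≤ k →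
      MeasurableSet S → S ⊆ inner j → S ⊆ Metric.closedBall c (R * (1 / 2) ^ i) →
      ∫⁻ x, gmcMass γ k S x ^ (q + 1) ∂gaussLaw ≤
        C * volume S * 2 ^ (-(i * (ξ - γ ^ 2 * q)) + j * (e + γ ^ 2 * q)) := by
  -- Two points of a ball of radius `R 2 ^ (-i)` are at distance at most `2 R 2 ^ (-i)`.
  obtain ⟨C₀, hcov⟩ := exists_cov_le (show 0 < 2 * R by positivity)
  obtain ⟨C₁, hC₁, hmom⟩ := h (2 * R) (by positivity)
  set δ := (ξ - γ ^ 2 * q) / 2 with hδ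
  -- The scale `l` contributes `2 ^ (-(ξ - γ² q) l) = 2 ^ (-2δ l)`; half of this decay pays for the
  -- loss in `hsum`, and the other half makes the sum over `l` converge.
  have hδ0 : 0 < δ := by rw [hδ]; linarith
  obtain ⟨C₂, hC₂, hsum⟩ := exists_tsum_rpow_le hq hδ0
  set K : ℝ≥0∞ := ENNReal.ofReal (Real.exp (γ ^ 2 * C₀)) with hK
  set Z : ℝ≥0∞ := ∑' t : ℕ, (2 : ℝ≥0∞) ^ (-(δ * t)) with hZ
  have hZt : Z ≠ ⊤ := tsum_two_rpow_neg_ne_top hδ0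
  refine ⟨C₂ * K ^ q * C₁ * Z, ENNReal.mul_ne_top (ENNReal.mul_ne_top (ENNReal.mul_ne_top hC₂
    (ENNReal.rpow_ne_top_of_nonneg hq.le ENNReal.ofReal_ne_top)) hC₁) hZt,
    fun k i j c S hik hS hSj hSc => ?_⟩
  have hpow : ∀ x, gmcMass γ k S x ^ (q + 1) = gmcMass γ k S x * gmcMass γ k S x ^ q := by
    intro x
    rw [ENNReal.rpow_add_of_nonneg _ _ hq.le zero_le_one, ENNReal.rpow_one, mul_comm]
  simp_rw [hpow]
  rw [lintegral_gmcMass_mul _ _ _ (by fun_prop)]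
  set N : ℕ → ℝ → Sample → ℝ≥0∞ := fun l t x => if 2 ^ (i + l) ≤ k then
    gmcMass γ k (S ∩ Metric.closedBall t (2 * R * (1 / 2) ^ (i + l))) x else 0 with hN
  have hNm : ∀ l t, Measurable (N l t) := by
    intro l t
    simp only [hN]
    split_ifs <;> fun_prop
  -- Every `u` in `S` is charged to the scale `l` supplied by `hcov`, at which the Cameron–Martin
  -- factor is at most `K 2 ^ (γ² (i + l + j))` and `u` lies in the ball of radius `2 R 2 ^
  -- (-(i+l))` about `t`.
  have key : ∀ t ∈ S, ∀ x, gmcMass γ k S (x + wickShift γ k t) ≤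
      ∑' l : ℕ, K * 2 ^ (γ ^ 2 * (i + l + j)) * N l t x := by
    intro t ht x
    unfold gmcMass
    calc _ ≤ ∫⁻ u in S, ∑' l : ℕ, K * 2 ^ (γ ^ 2 * (i + l + j)) * (if 2 ^ (i + l) ≤ k then
          (Metric.closedBall t (2 * R * (1 / 2) ^ (i + l))).indicator
            (fun u => ENNReal.ofReal (wickExp γ k x u)) u else 0) := by
          refine setLIntegral_mono' hS fun u hu => ?_
          rw [wickExp_add_wickShift]
          have hd : |u - t| ≤ 2 * R * (1 / 2) ^ i := by
            have h1 := hSc hu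
            have h2 := hSc ht
            rw [Metric.mem_closedBall, Real.dist_eq, abs_le] at h1 h2
            rw [abs_le]
            constructor <;> linarith [h1.1, h1.2, h2.1, h2.2]
          obtain ⟨l, hl1, hl2, hl3⟩ := hcov k i j t u hik (hSj ht) (hSj hu) hd
          refine le_trans ?_ (ENNReal.le_tsum l)
          have hmem : u ∈ Metric.closedBall t (2 * R * (1 / 2) ^ (i + l)) := by
            rw [Metric.mem_closedBall, Real.dist_eq]; exact hl2
          rw [if_pos hl1, Set.indicator_of_mem hmem, ENNReal.ofReal_mul (Real.exp_pos _).le]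
          gcongr
          rw [hK, ← ofReal_exp_mul_log_two, ← ENNReal.ofReal_mul (Real.exp_pos _).le,
            ← Real.exp_add]
          refine ENNReal.ofReal_le_ofReal (Real.exp_le_exp.2 ?_)
          calc γ ^ 2 * cov k u t ≤ γ ^ 2 * (C₀ + (i + l + j) * Real.log 2) := by gcongr
            _ = _ := by ring
      _ = ∑' l : ℕ, K * 2 ^ (γ ^ 2 * (i + l + j)) * N l t x := by
          have hw := (measurable_wickExp_right γ k x).ennreal_ofReal
          have hm : ∀ l : ℕ, Measurable (fun u => if 2 ^ (i + l) ≤ k then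
              (Metric.closedBall t (2 * R * (1 / 2) ^ (i + l))).indicator
              (fun u => ENNReal.ofReal (wickExp γ k x u)) u else 0) := by
            intro l
            split_ifs
            · exact hw.indicator measurableSet_closedBall
            · fun_prop
          rw [lintegral_tsum (fun l => ((hm l).const_mul _).aemeasurable)]
          congr 1
          ext l
          rw [lintegral_const_mul _ (hm l)]
          congr 1
          simp only [hN]
          split_ifs
          · rw [gmcMass, setLIntegral_indicator measurableSet_closedBall, Set.inter_comm]
          · simp
  have hbound : ∀ t ∈ S, ∫⁻ x, ENNReal.ofReal (wickExp γ k x t) * gmcMass γ k S x ^ q ∂gaussLaw ≤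
      C₂ * K ^ q * C₁ * Z * 2 ^ (-(i * (ξ - γ ^ 2 * q)) + j * (e + γ ^ 2 * q)) := by
    intro t ht
    rw [lintegral_wickExp_mul γ k t (by fun_prop)]
    calc _ ≤ ∫⁻ x, C₂ * ∑' l : ℕ, 2 ^ (δ * l) *
          (K * 2 ^ (γ ^ 2 * (i + l + j)) * N l t x) ^ q ∂gaussLaw := by
          refine lintegral_mono fun x => ?_
          exact (ENNReal.rpow_le_rpow (key t ht x) hq.le).trans (hsum _)
      _ = C₂ * ∑' l : ℕ, ∫⁻ x, 2 ^ (δ * l) *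
          (K * 2 ^ (γ ^ 2 * (i + l + j)) * N l t x) ^ q ∂gaussLaw := by
          rw [lintegral_const_mul' _ _ hC₂, lintegral_tsum]
          intro l
          have := hNm l t
          fun_prop
      _ ≤ C₂ * ∑' l : ℕ, K ^ q * C₁ *
          2 ^ (-(i * (ξ - γ ^ 2 * q)) + j * (e + γ ^ 2 * q)) * 2 ^ (-(δ * l)) := by
          gcongr with l
          have h1 : ∀ x, (2 : ℝ≥0∞) ^ (δ * l) *
              (K * 2 ^ (γ ^ 2 * (i + l + j)) * N l t x) ^ q =
              (2 ^ (δ * l) * (K ^ q * 2 ^ (γ ^ 2 * (i + l + j) * q))) * N l t x ^ q := by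
            intro x
            rw [ENNReal.mul_rpow_of_nonneg _ _ hq.le, ENNReal.mul_rpow_of_nonneg _ _ hq.le,
              ← ENNReal.rpow_mul]
            ring
          simp_rw [h1]
          rw [lintegral_const_mul _ ((hNm l t).pow_const q)]
          have h2 : ∫⁻ x, N l t x ^ q ∂gaussLaw ≤ C₁ * 2 ^ (-((i + l : ℕ) * ξ) + j * e) := by
            simp only [hN]
            split_ifs with hil
            · exact hmom k (i + l) j t _ hil (hS.inter measurableSet_closedBall)
                (Set.inter_subset_left.trans hSj) Set.inter_subset_right
            · simp [ENNReal.zero_rpow_of_pos hq]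
          calc _ ≤ 2 ^ (δ * l) * (K ^ q * 2 ^ (γ ^ 2 * (i + l + j) * q)) *
                (C₁ * 2 ^ (-((i + l : ℕ) * ξ) + j * e)) := by gcongr
            _ = K ^ q * C₁ * (2 ^ (δ * l + γ ^ 2 * (i + l + j) * q +
                (-((i + l : ℕ) * ξ) + j * e))) := by
                rw [two_rpow_add (δ * l + γ ^ 2 * (i + l + j) * q), two_rpow_add (δ * l)]; ring
            _ = _ := by
                rw [mul_assoc _ (2 ^ _) (2 ^ _), ← two_rpow_add]
                congr 2
                push_cast
                rw [hδ]
                ring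
      _ = _ := by
          rw [ENNReal.tsum_mul_left]
          ring
  calc _ ≤ ∫⁻ t in S, C₂ * K ^ q * C₁ * Z *
        2 ^ (-(i * (ξ - γ ^ 2 * q)) + j * (e + γ ^ 2 * q)) :=
        setLIntegral_mono' hS hbound
    _ = _ := by rw [setLIntegral_const]; ring

lemma MomentBound.succ {γ q ξ e : ℝ} (h : MomentBound γ q ξ e) (hq : 0 < q)
    (hξ : γ ^ 2 * q < ξ) : MomentBound γ (q + 1) (ξ - γ ^ 2 * q + 1) (e + γ ^ 2 * q) := by
  intro R hR
  obtain ⟨C, hC, hb⟩ := h.lintegral_rpow_add_one_le hq hξ hR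
  refine ⟨C * ENNReal.ofReal (2 * R), ENNReal.mul_ne_top hC ENNReal.ofReal_ne_top,
    fun k i j c S hik hS hSj hSc => (hb k i j c S hik hS hSj hSc).trans ?_⟩
  calc _ ≤ C * (ENNReal.ofReal (2 * R) * 2 ^ (-(i : ℝ))) *
        2 ^ (-(i * (ξ - γ ^ 2 * q)) + j * (e + γ ^ 2 * q)) := by
        gcongr; exact volume_le_of_subset_closedBall hR i hSc
    _ = C * ENNReal.ofReal (2 * R) *
        2 ^ (-(i : ℝ) + (-(i * (ξ - γ ^ 2 * q)) + j * (e + γ ^ 2 * q))) := by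
        rw [two_rpow_add (-(i : ℝ))]; ring
    _ = _ := by congr 2; ring

/-- The exponent `ξ(q) = q + γ² q (1 - q) / 2` satisfies `ξ(q+1) = ξ(q) - γ² q + 1`, and the
condition `γ² q < ξ(q)` for passing to `q + 1` reads `γ² (q + 1) < 2`. The bound on `e` is cruder
than the sum of the increments `γ² (s + i)`, but suffices to reach `pTwo`. -/
lemma exists_momentBound {γ s : ℝ} (hγ : 0 < γ) (hs0 : 0 < s) (hs1 : s < 1) (n : ℕ)
    (hn : γ ^ 2 * (s + n) < 2) : ∃ e : ℝ, e ≤ γ ^ 2 * (n * (s + n - 1)) ∧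
      MomentBound γ (s + n) (s + n + γ ^ 2 * ((s + n) * (1 - (s + n))) / 2) e := by
  have hγ2 : 0 < γ ^ 2 := by positivity
  induction n with
  | zero =>
    refine ⟨0, by simp, ?_⟩
    simpa using momentBound_of_lt_one γ s hγ hs0 hs1
  | succ n ih =>
    push_cast at hn ⊢
    obtain ⟨e, he, hb⟩ := ih (by nlinarith)
    have hq : 0 < s + n := by positivity
    refine ⟨e + γ ^ 2 * (s + n), ?_, ?_⟩
    · have h1 : (n : ℝ) * (s + n - 1) + (s + n) ≤ (n + 1) * (s + (n + 1) - 1) := by nlinarith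
      have := mul_le_mul_of_nonneg_left h1 hγ2.le
      linarith
    · have := hb.succ hq (by nlinarith)
      convert this using 1 <;> ring

/-! ### Moments of the weighted total mass -/

/-- The weight `(1 / (2 |sin t|)) ^ α`. -/
def weight (α t : ℝ) : ℝ := (1 / (2 * |Real.sin t|)) ^ α

lemma weight_nonneg (α t : ℝ) : 0 ≤ weight α t := by unfold weight; positivity

@[fun_prop]
lemma measurable_weight (α : ℝ) : Measurable (weight α) := by unfold weight; fun_prop

/-- The dyadic layers of `(0, π)` according to the distance to the boundary. -/
def layer (j : ℕ) : Set ℝ := inner j ∩ {t | Real.sin t ≤ (1 / 2 : ℝ) ^ j}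

lemma measurableSet_layer (j : ℕ) : MeasurableSet (layer j) := by
  have h1 : MeasurableSet (inner j) :=
    measurableSet_Ioo.inter (measurableSet_lt measurable_const Real.measurable_sin)
  exact h1.inter (measurableSet_le Real.measurable_sin measurable_const)

lemma Ioo_subset_iUnion_layer : Set.Ioo 0 Real.pi ⊆ ⋃ j, layer j := by
  intro t ht
  obtain ⟨j, hj1, hj2⟩ := exists_nat_pow_near_of_lt_one (Real.sin_pos_of_mem_Ioo ht)
    (Real.sin_le_one t) (show (0 : ℝ) < 1 / 2 by norm_num) (by norm_num)
  exact Set.mem_iUnion.2 ⟨j, ⟨ht, hj1⟩, hj2⟩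

lemma volume_layer_le (j : ℕ) : volume (layer j) ≤ ENNReal.ofReal Real.pi * 2 ^ (-(j : ℝ)) := by
  have hpi := Real.pi_pos
  have hsub : layer j ⊆ Set.Icc 0 (Real.pi / 2 * (1 / 2) ^ j) ∪
      Set.Icc (Real.pi - Real.pi / 2 * (1 / 2) ^ j) Real.pi := by
    rintro t ⟨⟨⟨h0, h1⟩, -⟩, h2⟩
    simp only [Set.mem_ofPred_eq] at h2
    have key : ∀ u, 0 ≤ u → u ≤ Real.pi / 2 → Real.sin u ≤ (1 / 2 : ℝ) ^ j →
        u ≤ Real.pi / 2 * (1 / 2) ^ j := by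
      intro u hu0 hu1 hu2
      have := Real.mul_le_sin hu0 hu1
      have h3 : 2 / Real.pi * u ≤ (1 / 2) ^ j := this.trans hu2
      rw [div_mul_eq_mul_div, div_le_iff₀ hpi] at h3
      linarith
    rcases le_total t (Real.pi / 2) with h | h
    · exact Or.inl ⟨h0.le, key t h0.le h h2⟩
    · have := key (Real.pi - t) (by linarith) (by linarith) (by rwa [Real.sin_pi_sub])
      exact Or.inr ⟨by linarith, h1.le⟩
  refine (measure_mono hsub).trans ((measure_union_le _ _).trans ?_)
  rw [Real.volume_Icc, Real.volume_Icc, ← ENNReal.ofReal_add (by simp; positivity)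
    (by simp; positivity), ← ofReal_half_pow, ← ENNReal.ofReal_mul hpi.le]
  exact ENNReal.ofReal_le_ofReal (by linarith)

lemma weight_le_of_mem_layer {α : ℝ} (hα : 0 < α) {j : ℕ} {t : ℝ} (ht : t ∈ layer j) :
    ENNReal.ofReal (weight α t) ≤ 2 ^ (j * α) := by
  obtain ⟨⟨-, h⟩, -⟩ := ht
  have hp : (0 : ℝ) < (1 / 2) ^ (j + 1) := by positivity
  have hs : 0 < Real.sin t := hp.trans h
  have h1 : 1 / (2 * |Real.sin t|) ≤ (2 : ℝ) ^ j := by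
    rw [abs_of_pos hs, div_le_iff₀ (by positivity)]
    have h2 : (2 : ℝ) ^ j * (2 * (1 / 2) ^ (j + 1)) = 1 := by
      rw [pow_succ, show (2 : ℝ) ^ j * (2 * ((1 / 2) ^ j * (1 / 2))) = (2 * (1 / 2)) ^ j by
        rw [mul_pow]; ring]
      norm_num
    rw [← h2]
    gcongr
  calc ENNReal.ofReal (weight α t) ≤ ENNReal.ofReal (((2 : ℝ) ^ j) ^ α) :=
        ENNReal.ofReal_le_ofReal (Real.rpow_le_rpow (by positivity) h1 hα.le)
    _ = _ := by
        rw [← ENNReal.ofReal_rpow_of_pos (by positivity), ENNReal.ofReal_pow (by norm_num),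
          ← ENNReal.rpow_natCast, ← ENNReal.rpow_mul]
        norm_num

/-- The total mass of the approximate chaos with weight `g`, in `ℝ≥0∞`. -/
def massE (γ : ℝ) (g : ℝ → ℝ) (k : ℕ) (x : Sample) : ℝ≥0∞ :=
  ∫⁻ t in Set.Ioo 0 Real.pi, ENNReal.ofReal (wickExp γ k x t * g t)

lemma massE_weight_le {α : ℝ} (hα : 0 < α) (γ : ℝ) (k : ℕ) (x : Sample) :
    massE γ (weight α) k x ≤ ∑' j : ℕ, 2 ^ (j * α) * gmcMass γ k (layer j) x := by
  unfold massE
  refine (lintegral_mono_set Ioo_subset_iUnion_layer).trans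
    ((lintegral_iUnion_le _ _).trans (ENNReal.tsum_le_tsum fun j => ?_))
  unfold gmcMass
  rw [← lintegral_const_mul _ (measurable_wickExp_right γ k x).ennreal_ofReal]
  refine setLIntegral_mono' (measurableSet_layer j) fun t ht => ?_
  rw [ENNReal.ofReal_mul (wickExp_pos _ _ _ _).le, mul_comm]
  gcongr
  exact weight_le_of_mem_layer hα ht

/-- Uniform bound for the moments of order `p = s + n + 1` with `0 < s < 1`. -/
lemma exists_lintegral_massE_rpow_le {γ α s : ℝ} (hγ : 0 < γ) (hα : 0 < α) (hs0 : 0 < s)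
    (hs1 : s < 1) (n : ℕ) (hp : γ ^ 2 * (s + n + 1) < 2)
    (hp2 : γ ^ 2 * ((s + n + 1) * (s + n)) + α * (s + n + 1) < 1) :
    ∃ C : ℝ≥0∞, C ≠ ⊤ ∧ ∀ k : ℕ, 1 ≤ k →
      ∫⁻ x, massE γ (weight α) k x ^ (s + n + 1) ∂gaussLaw ≤ C := by
  have hγ2 : 0 < γ ^ 2 := by positivity
  obtain ⟨e, he, hb⟩ := exists_momentBound hγ hs0 hs1 n (by nlinarith)
  have hq : 0 < s + n := by positivity
  obtain ⟨C, hC, hbound⟩ := hb.lintegral_rpow_add_one_le hq (by nlinarith)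
    (show (0 : ℝ) < 4 by norm_num)
  set p := s + n + 1 with hpdef
  have hp0 : 0 < p := by positivity
  set E := e + γ ^ 2 * (s + n) with hE
  have hEp : E ≤ γ ^ 2 * (p * (s + n)) := by
    have h1 : (n : ℝ) * (s + n - 1) + (s + n) ≤ p * (s + n) := by
      have : (0 : ℝ) ≤ n := Nat.cast_nonneg n
      rw [hpdef]; nlinarith
    have := mul_le_mul_of_nonneg_left h1 hγ2.le
    linarith
  -- The layer `j` contributes `2 ^ (-j (1 - α p - E))`: the volume gives `-1`, the weight `α p`,
  -- the boundary term `E`. Half of the decay absorbs the loss in `hsum`.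
  set δ := (1 - α * p - E) / 2 with hδ
  have hδ0 : 0 < δ := by rw [hδ]; linarith
  obtain ⟨C₂, hC₂, hsum⟩ := exists_tsum_rpow_le hp0 hδ0
  refine ⟨C₂ * (C * ENNReal.ofReal Real.pi * ∑' j : ℕ, 2 ^ (-(δ * j))),
    ENNReal.mul_ne_top hC₂ (ENNReal.mul_ne_top (ENNReal.mul_ne_top hC ENNReal.ofReal_ne_top)
      (tsum_two_rpow_neg_ne_top hδ0)), fun k hk => ?_⟩
  calc _ ≤ ∫⁻ x, C₂ * ∑' j : ℕ, 2 ^ (δ * j) *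
        (2 ^ (j * α) * gmcMass γ k (layer j) x) ^ p ∂gaussLaw :=
        lintegral_mono fun x => (ENNReal.rpow_le_rpow (massE_weight_le hα γ k x) hp0.le).trans
          (hsum _)
    _ = C₂ * ∑' j : ℕ, ∫⁻ x, 2 ^ (δ * j) *
        (2 ^ (j * α) * gmcMass γ k (layer j) x) ^ p ∂gaussLaw := by
        rw [lintegral_const_mul' _ _ hC₂, lintegral_tsum]
        intro j
        fun_prop
    _ ≤ C₂ * ∑' j : ℕ, C * ENNReal.ofReal Real.pi * 2 ^ (-(δ * j)) := by
        gcongr with j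
        have h1 : ∀ x, (2 : ℝ≥0∞) ^ (δ * j) * (2 ^ (j * α) * gmcMass γ k (layer j) x) ^ p =
            2 ^ (δ * j + j * α * p) * gmcMass γ k (layer j) x ^ p := by
          intro x
          rw [ENNReal.mul_rpow_of_nonneg _ _ hp0.le, ← ENNReal.rpow_mul, two_rpow_add]
          ring
        simp_rw [h1]
        rw [lintegral_const_mul _ (by fun_prop)]
        -- Scale `i = 0` with radius `4 > π` covers each layer at once for every `k ≥ 1`. The last
        -- step of the induction is taken in the form that keeps `volume S`, since a layer has
        -- measure of order `2 ^ (-j)`.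
        have h2 := hbound k 0 j 0 (layer j) (by simpa using hk) (measurableSet_layer j)
          Set.inter_subset_left (by
            intro t ht
            have h3 := ht.1.1
            have := Real.pi_lt_four
            rw [Metric.mem_closedBall, Real.dist_eq, sub_zero, abs_of_pos h3.1]
            simp only [pow_zero, mul_one]
            linarith [h3.2])
        calc _ ≤ 2 ^ (δ * j + j * α * p) * (C * (ENNReal.ofReal Real.pi * 2 ^ (-(j : ℝ))) *
              2 ^ (-((0 : ℕ) * (s + n + γ ^ 2 * ((s + n) * (1 - (s + n))) / 2 - γ ^ 2 * (s + n)))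
                + j * E)) := by
              gcongr
              refine h2.trans ?_
              gcongr
              exact volume_layer_le j
          _ = C * ENNReal.ofReal Real.pi * 2 ^ ((δ * j + j * α * p) + (-(j : ℝ) + j * E)) := by
              rw [two_rpow_add (δ * j + j * α * p), two_rpow_add (-(j : ℝ))]
              simp only [Nat.cast_zero, zero_mul, neg_zero, zero_add]
              ring
          _ = _ := by
              congr 2
              rw [hδ]; ring
    _ = _ := by rw [ENNReal.tsum_mul_left]

/-! ### The martingale of weighted masses -/

/-- Measurable nonnegative weights dominated by `weight α` on `(0, π)`. -/
structure IsWeight (α : ℝ) (g : ℝ → ℝ) : Prop where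
  measurable : Measurable g
  nonneg : ∀ t, 0 ≤ g t
  le : ∀ t ∈ Set.Ioo 0 Real.pi, g t ≤ weight α t

lemma isWeight_weight (α : ℝ) : IsWeight α (weight α) :=
  ⟨measurable_weight α, weight_nonneg α, fun _ _ => le_rfl⟩

/-- The total mass of the approximate chaos with weight `g`. -/
def massR (γ : ℝ) (g : ℝ → ℝ) (k : ℕ) (x : Sample) : ℝ :=
  ∫ t in Set.Ioo 0 Real.pi, wickExp γ k x t * g t

lemma integrableOn_weight {α : ℝ} (hα : 0 < α) (hα1 : α < 1) :
    IntegrableOn (weight α) (Set.Ioo 0 Real.pi) := by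
  refine ⟨(measurable_weight α).aestronglyMeasurable, ?_⟩
  rw [hasFiniteIntegral_iff_ofReal (Eventually.of_forall (weight_nonneg α))]
  -- At `γ = 0` the Wick exponential is `1`, so the decomposition into layers bounds the integral of
  -- the weight itself.
  have h := massE_weight_le hα 0 0 0
  have hw : ∀ t, wickExp 0 0 0 t = 1 := fun t => by simp [wickExp]
  simp only [massE, gmcMass, hw, one_mul, ENNReal.ofReal_one, setLIntegral_const] at h
  refine (h.trans (ENNReal.tsum_le_tsum (g := fun j : ℕ => ENNReal.ofReal Real.pi *
    2 ^ (-((1 - α) * j))) fun j => ?_)).trans_lt ?_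
  · calc _ ≤ (2 : ℝ≥0∞) ^ (j * α) * (ENNReal.ofReal Real.pi * 2 ^ (-(j : ℝ))) := by
          gcongr; exact volume_layer_le j
      _ = ENNReal.ofReal Real.pi * 2 ^ (j * α + -(j : ℝ)) := by rw [two_rpow_add]; ring
      _ = _ := by congr 2; ring
  · rw [ENNReal.tsum_mul_left]
    exact (ENNReal.mul_ne_top ENNReal.ofReal_ne_top
      (tsum_two_rpow_neg_ne_top (by linarith))).lt_top

lemma IsWeight.integrableOn {α : ℝ} {g : ℝ → ℝ} (hg : IsWeight α g)
    (hI : IntegrableOn (weight α) (Set.Ioo 0 Real.pi)) : IntegrableOn g (Set.Ioo 0 Real.pi) := by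
  refine Integrable.mono' hI hg.measurable.aestronglyMeasurable ?_
  refine ae_restrict_of_forall_mem measurableSet_Ioo fun t ht => ?_
  rw [Real.norm_of_nonneg (hg.nonneg t)]
  exact hg.le t ht

lemma integrableOn_continuous_mul_wickExp_mul {g f : ℝ → ℝ} (hf : Continuous f)
    (hI : IntegrableOn g (Set.Ioo 0 Real.pi)) (γ : ℝ) (k : ℕ) (x : Sample) :
    IntegrableOn (fun t => f t * (wickExp γ k x t * g t)) (Set.Ioo 0 Real.pi) := by
  have h := IntegrableOn.continuousOn_mul_of_subset (K := Set.Icc 0 Real.pi)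
    (hf.mul (continuous_wickExp γ k x)).continuousOn hI isCompact_Icc measurableSet_Ioo
    Set.Ioo_subset_Icc_self
  simpa only [Pi.mul_apply, mul_assoc] using h

lemma integrableOn_wickExp_mul {g : ℝ → ℝ} (hI : IntegrableOn g (Set.Ioo 0 Real.pi))
    (γ : ℝ) (k : ℕ) (x : Sample) :
    IntegrableOn (fun t => wickExp γ k x t * g t) (Set.Ioo 0 Real.pi) := by
  simpa using integrableOn_continuous_mul_wickExp_mul continuous_const (f := fun _ => 1) hI γ k x

lemma massR_nonneg {g : ℝ → ℝ} (h0 : ∀ t, 0 ≤ g t) (γ : ℝ) (k : ℕ) (x : Sample) :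
    0 ≤ massR γ g k x :=
  integral_nonneg fun t => mul_nonneg (wickExp_pos _ _ _ _).le (h0 t)

lemma massR_mono {f g : ℝ → ℝ} (hf : IntegrableOn f (Set.Ioo 0 Real.pi))
    (hg : IntegrableOn g (Set.Ioo 0 Real.pi)) (hfg : ∀ t ∈ Set.Ioo 0 Real.pi, f t ≤ g t)
    (γ : ℝ) (k : ℕ) (x : Sample) : massR γ f k x ≤ massR γ g k x :=
  setIntegral_mono_on (integrableOn_wickExp_mul hf γ k x) (integrableOn_wickExp_mul hg γ k x)
    measurableSet_Ioo fun t ht => mul_le_mul_of_nonneg_left (hfg t ht) (wickExp_pos _ _ _ _).le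

lemma massE_eq_ofReal {g : ℝ → ℝ} (h0 : ∀ t, 0 ≤ g t) (hI : IntegrableOn g (Set.Ioo 0 Real.pi))
    (γ : ℝ) (k : ℕ) (x : Sample) : massE γ g k x = ENNReal.ofReal (massR γ g k x) := by
  rw [massR, ofReal_integral_eq_lintegral_ofReal (integrableOn_wickExp_mul hI γ k x)
    (Eventually.of_forall fun t => mul_nonneg (wickExp_pos _ _ _ _).le (h0 t))]
  rfl

lemma massR_eq_toReal {g : ℝ → ℝ} (h0 : ∀ t, 0 ≤ g t) (hI : IntegrableOn g (Set.Ioo 0 Real.pi))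
    (γ : ℝ) (k : ℕ) (x : Sample) : massR γ g k x = (massE γ g k x).toReal := by
  rw [massE_eq_ofReal h0 hI, ENNReal.toReal_ofReal (massR_nonneg h0 γ k x)]

lemma measurable_wickExp_mul {g : ℝ → ℝ} (hg : Measurable g) (γ : ℝ) (k : ℕ) :
    Measurable (fun z : Sample × ℝ => ENNReal.ofReal (wickExp γ k z.1 z.2 * g z.2)) :=
  ((measurable_wickExp_uncurry γ k).mul (hg.comp measurable_snd)).ennreal_ofReal

lemma measurable_massE {g : ℝ → ℝ} (hg : Measurable g) (γ : ℝ) (k : ℕ) :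
    Measurable (massE γ g k) := by
  unfold massE
  exact Measurable.lintegral_prod_right (measurable_wickExp_mul hg γ k)

lemma measurable_massR {g : ℝ → ℝ} (hg : Measurable g) (h0 : ∀ t, 0 ≤ g t)
    (hI : IntegrableOn g (Set.Ioo 0 Real.pi)) (γ : ℝ) (k : ℕ) : Measurable (massR γ g k) := by
  have : massR γ g k = fun x => (massE γ g k x).toReal := by
    ext x; exact massR_eq_toReal h0 hI γ k x
  rw [this]
  exact (measurable_massE hg γ k).ennreal_toReal

lemma lintegral_massE_mul {g : ℝ → ℝ} (hg : Measurable g) (γ : ℝ) (k : ℕ) {F : Sample → ℝ≥0∞}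
    (hF : Measurable F) : ∫⁻ x, massE γ g k x * F x ∂gaussLaw =
      ∫⁻ t in Set.Ioo 0 Real.pi, ENNReal.ofReal (g t) *
        ∫⁻ x, F (x + wickShift γ k t) ∂gaussLaw := by
  have h : ∀ x, massE γ g k x * F x =
      ∫⁻ t in Set.Ioo 0 Real.pi, ENNReal.ofReal (wickExp γ k x t * g t) * F x := fun x =>
    (lintegral_mul_const _ ((measurable_wickExp_right γ k x).mul hg).ennreal_ofReal).symm
  simp_rw [h]
  rw [lintegral_lintegral_swap (Measurable.aemeasurable ?_)]
  · refine lintegral_congr fun t => ?_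
    rw [← lintegral_wickExp_mul γ k t hF, ← lintegral_const_mul' _ _ ENNReal.ofReal_ne_top]
    refine lintegral_congr fun x => ?_
    rw [ENNReal.ofReal_mul (wickExp_pos _ _ _ _).le]
    ring
  · exact (measurable_wickExp_mul hg γ k).mul (hF.comp measurable_fst)

lemma lintegral_massE {g : ℝ → ℝ} (hg : Measurable g) (γ : ℝ) (k : ℕ) :
    ∫⁻ x, massE γ g k x ∂gaussLaw = ∫⁻ t in Set.Ioo 0 Real.pi, ENNReal.ofReal (g t) := by
  have := lintegral_massE_mul hg γ k (F := fun _ => 1) measurable_const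
  simpa using this

/-- The first `k` coordinates of a sample. -/
def restr (k : ℕ) (x : Sample) : ℕ → ℝ := fun n => if n < k then x n.succPNat else 0

/-- A sequence seen as a sample. -/
def toSample (y : ℕ → ℝ) : Sample := fun i => y i.natPred

lemma measurable_toSample : Measurable toSample := by unfold toSample; fun_prop

lemma measurable_restr (k : ℕ) : Measurable (restr k) := by
  unfold restr
  refine measurable_pi_lambda _ fun n => ?_
  split_ifs <;> fun_prop

/-- The filtration generated by the coordinates. -/
def coordFiltration : Filtration ℕ (inferInstance : MeasurableSpace Sample) where
  seq k := MeasurableSpace.comap (restr k) inferInstance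
  mono' := by
    intro k m hkm
    have h : restr k = (fun (y : ℕ → ℝ) (n : ℕ) => if n < k then y n else 0) ∘ restr m := by
      ext x n
      simp only [restr, Function.comp_apply]
      split_ifs <;> first | rfl | omega
    have hmeas : Measurable (fun (y : ℕ → ℝ) (n : ℕ) => if n < k then y n else 0) := by
      refine measurable_pi_lambda _ fun n => ?_
      split_ifs <;> fun_prop
    change MeasurableSpace.comap (restr k) _ ≤ MeasurableSpace.comap (restr m) _
    rw [h, ← MeasurableSpace.comap_comp]
    exact MeasurableSpace.comap_mono hmeas.comap_le
  le' k := (measurable_restr k).comap_le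

lemma wickExp_toSample_restr (γ : ℝ) (k : ℕ) (x : Sample) (t : ℝ) :
    wickExp γ k (toSample (restr k x)) t = wickExp γ k x t := by
  have : field k (toSample (restr k x)) t = field k x t := by
    rw [field_eq_linForm, field_eq_linForm]
    unfold linForm
    refine Finset.sum_congr rfl fun n hn => ?_
    simp [toSample, restr, Finset.mem_range.1 hn]
  simp only [wickExp, this]

lemma restr_add_wickShift (γ : ℝ) {k m : ℕ} (hkm : k ≤ m) (x : Sample) (t : ℝ) :
    restr k (x + wickShift γ m t) = restr k (x + wickShift γ k t) := by
  ext n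
  simp only [restr]
  split_ifs with hn
  · simp [wickShift, shift, hn, hn.trans_le hkm]
  · rfl

lemma integrable_massR {α : ℝ} {g : ℝ → ℝ} (hg : IsWeight α g)
    (hI : IntegrableOn (weight α) (Set.Ioo 0 Real.pi)) (γ : ℝ) (k : ℕ) :
    Integrable (massR γ g k) gaussLaw := by
  have hgI := hg.integrableOn hI
  refine ⟨(measurable_massR hg.measurable hg.nonneg hgI γ k).aestronglyMeasurable, ?_⟩
  rw [hasFiniteIntegral_iff_ofReal (Eventually.of_forall (massR_nonneg hg.nonneg γ k))]
  simp_rw [← massE_eq_ofReal hg.nonneg hgI]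
  rw [lintegral_massE hg.measurable]
  exact (hasFiniteIntegral_iff_ofReal (Eventually.of_forall hg.nonneg)).1 hgI.2

/-- The Cameron–Martin formula expresses the integral over `A` by the probabilities of translates of
`A`, so that the martingale property can be checked without computing a conditional expectation. -/
lemma setIntegral_massR {α : ℝ} {g : ℝ → ℝ} (hg : IsWeight α g)
    (hI : IntegrableOn (weight α) (Set.Ioo 0 Real.pi)) (γ : ℝ) (k : ℕ) {A : Set Sample}
    (hA : MeasurableSet A) : ∫ x in A, massR γ g k x ∂gaussLaw =
      (∫⁻ t in Set.Ioo 0 Real.pi, ENNReal.ofReal (g t) *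
        ∫⁻ x, A.indicator 1 (x + wickShift γ k t) ∂gaussLaw).toReal := by
  have hgI := hg.integrableOn hI
  rw [integral_eq_lintegral_of_nonneg_ae (Eventually.of_forall (massR_nonneg hg.nonneg γ k))
    (measurable_massR hg.measurable hg.nonneg hgI γ k).aestronglyMeasurable]
  simp_rw [← massE_eq_ofReal hg.nonneg hgI]
  rw [← lintegral_indicator hA, ← lintegral_massE_mul hg.measurable γ k
    (measurable_one.indicator hA)]
  congr 1
  refine lintegral_congr fun x => ?_
  by_cases hx : x ∈ A <;> simp [hx]

/-- An event depending on the first `i` coordinates does not see the difference between the shifts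
truncated at `i` and at `j ≥ i`, so both masses have the same integral over it. -/
lemma martingale_massR {α : ℝ} {g : ℝ → ℝ} (hg : IsWeight α g)
    (hI : IntegrableOn (weight α) (Set.Ioo 0 Real.pi)) (γ : ℝ) :
    Martingale (massR γ g) coordFiltration gaussLaw := by
  have hgI := hg.integrableOn hI
  have hadapt : StronglyAdapted coordFiltration (massR γ g) := by
    intro k
    have h : massR γ g k = (massR γ g k ∘ toSample) ∘ restr k := by
      ext x
      simp only [Function.comp_apply, massR, wickExp_toSample_restr]
    have hm : Measurable[MeasurableSpace.comap (restr k) inferInstance]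
        ((massR γ g k ∘ toSample) ∘ restr k) :=
      ((measurable_massR hg.measurable hg.nonneg hgI γ k).comp measurable_toSample).comp
        (comap_measurable _)
    rw [h]
    exact hm.stronglyMeasurable
  refine ⟨hadapt, fun i j hij => ?_⟩
  refine (ae_eq_condExp_of_forall_setIntegral_eq (coordFiltration.le i)
    (integrable_massR hg hI γ j) (fun _ _ _ => (integrable_massR hg hI γ i).integrableOn) ?_
    (hadapt i).aestronglyMeasurable).symm
  intro A hA _
  rw [setIntegral_massR hg hI γ i (coordFiltration.le i A hA),
    setIntegral_massR hg hI γ j (coordFiltration.le i A hA)]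
  obtain ⟨B, -, rfl⟩ := hA
  congr 1
  refine lintegral_congr fun t => ?_
  congr 1
  refine lintegral_congr fun x => ?_
  have h := restr_add_wickShift γ hij x t
  have hiff : x + wickShift γ j t ∈ restr i ⁻¹' B ↔ x + wickShift γ i t ∈ restr i ⁻¹' B := by
    rw [Set.mem_preimage, Set.mem_preimage, h]
  by_cases hx : x + wickShift γ i t ∈ restr i ⁻¹' B
  · rw [Set.indicator_of_mem hx, Set.indicator_of_mem (hiff.2 hx)]; rfl
  · rw [Set.indicator_of_notMem hx, Set.indicator_of_notMem (fun h => hx (hiff.1 h))]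

/-- The almost sure limit of the masses with weight `g`. -/
def limMass (γ : ℝ) (g : ℝ → ℝ) (x : Sample) : ℝ := limUnder atTop fun k => massR γ g k x

lemma ae_tendsto_limMass {α : ℝ} {g : ℝ → ℝ} (hg : IsWeight α g)
    (hI : IntegrableOn (weight α) (Set.Ioo 0 Real.pi)) (γ : ℝ) :
    ∀ᵐ x ∂gaussLaw, Tendsto (fun k => massR γ g k x) atTop (𝓝 (limMass γ g x)) := by
  have hgI := hg.integrableOn hI
  have hex := (martingale_massR hg hI γ).submartingale.exists_ae_tendsto_of_bdd
    (R := (∫⁻ t in Set.Ioo 0 Real.pi, ENNReal.ofReal (g t)).toNNReal) ?_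
  · exact hex.mono fun x hx => tendsto_nhds_limUnder hx
  intro k
  have hfin : ∫⁻ t in Set.Ioo 0 Real.pi, ENNReal.ofReal (g t) ≠ ⊤ :=
    ((hasFiniteIntegral_iff_ofReal (Eventually.of_forall hg.nonneg)).1 hgI.2).ne
  rw [ENNReal.coe_toNNReal hfin, ← lintegral_massE hg.measurable γ k, eLpNorm_one_eq_lintegral_enorm]
  refine lintegral_mono fun x => ?_
  rw [massE_eq_ofReal hg.nonneg hgI, Real.enorm_of_nonneg (massR_nonneg hg.nonneg γ k x)]

/-! ### Convergence in `L^p` from almost sure convergence and a bound in a larger `L^q` -/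

/-- A bound in `L^q` makes the family uniformly integrable in `L^p` for `p < q`, and Vitali's
theorem applies; Fatou puts the limit in `L^q`. -/
lemma tendsto_eLpNorm_of_ae_tendsto_of_bdd {Ω : Type*} [MeasurableSpace Ω] {μ : Measure Ω}
    [IsProbabilityMeasure μ] {f : ℕ → Ω → ℝ} {g : Ω → ℝ} {p q : ℝ} (hp : 1 ≤ p) (hpq : p < q)
    (hf : ∀ k, AEStronglyMeasurable (f k) μ) {C : ℝ≥0∞} (hC : C ≠ ⊤)
    (hb : ∀ k, eLpNorm (f k) (ENNReal.ofReal q) μ ≤ C)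
    (hlim : ∀ᵐ x ∂μ, Tendsto (fun k => f k x) atTop (𝓝 (g x))) :
    MemLp g (ENNReal.ofReal q) μ ∧
      Tendsto (fun k => eLpNorm (fun x => f k x - g x) (ENNReal.ofReal p) μ) atTop (𝓝 0) := by
  have hpq' : ENNReal.ofReal p ≤ ENNReal.ofReal q := ENNReal.ofReal_le_ofReal hpq.le
  have hg : MemLp g (ENNReal.ofReal q) μ := by
    refine ⟨aestronglyMeasurable_of_tendsto_ae atTop hf hlim, ?_⟩
    refine (Lp.eLpNorm_lim_le_liminf_eLpNorm hf g hlim).trans_lt (lt_of_le_of_lt ?_ hC.lt_top)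
    refine liminf_le_of_le (by isBoundedDefault) fun b hbb => ?_
    obtain ⟨k, hk⟩ := hbb.exists
    exact hk.trans (hb k)
  refine ⟨hg, ?_⟩
  refine tendsto_Lp_finite_of_tendsto_ae (by simpa using ENNReal.ofReal_le_ofReal hp)
    ENNReal.ofReal_ne_top hf (hg.mono_exponent hpq') ?_ hlim
  intro ε hε
  set a := 1 / p - 1 / q with ha
  have ha0 : 0 < a := by
    rw [ha, sub_pos]; exact one_div_lt_one_div_of_lt (by linarith) hpq
  have hC1 : 0 < C.toReal + 1 := by positivity
  -- On a set of measure at most `η`, Hölder bounds the `L^p` norm by `C η ^ a`; this `η` gives `C ε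
  -- / (C + 1) ≤ ε`.
  refine ⟨(ε / (C.toReal + 1)) ^ (1 / a), by positivity, fun k s hs hμs => ?_⟩
  rw [eLpNorm_indicator_eq_eLpNorm_restrict hs]
  refine (eLpNorm_le_eLpNorm_mul_rpow_measure_univ hpq' (hf k).restrict).trans ?_
  rw [ENNReal.toReal_ofReal (by linarith), ENNReal.toReal_ofReal (by linarith), ← ha,
    Measure.restrict_apply_univ]
  calc _ ≤ C * ENNReal.ofReal ((ε / (C.toReal + 1)) ^ (1 / a)) ^ a := by
        gcongr
        exact (eLpNorm_mono_measure _ Measure.restrict_le_self).trans (hb k)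
    _ = ENNReal.ofReal (C.toReal * (ε / (C.toReal + 1))) := by
        rw [ENNReal.ofReal_rpow_of_nonneg (by positivity) ha0.le, ← Real.rpow_mul (by positivity),
          one_div_mul_cancel ha0.ne', Real.rpow_one, ENNReal.ofReal_mul ENNReal.toReal_nonneg,
          ENNReal.ofReal_toReal hC]
    _ ≤ _ := by
        refine ENNReal.ofReal_le_ofReal ?_
        rw [mul_div_assoc', div_le_iff₀ hC1]
        nlinarith

/-- A bound for the moments of order `q` of the approximate masses. -/
def MassBound (γ α q : ℝ) (C : ℝ≥0∞) : Prop :=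
  C ≠ ⊤ ∧ ∀ k : ℕ, 1 ≤ k → ∫⁻ x, massE γ (weight α) k x ^ q ∂gaussLaw ≤ C

lemma MassBound.eLpNorm_le {γ α q : ℝ} {C : ℝ≥0∞} (h : MassBound γ α q C) (hq : 1 < q)
    {g : ℝ → ℝ} (hg : IsWeight α g) (hI : IntegrableOn (weight α) (Set.Ioo 0 Real.pi))
    {k : ℕ} (hk : 1 ≤ k) :
    eLpNorm (massR γ g k) (ENNReal.ofReal q) gaussLaw ≤ C ^ (1 / q) := by
  have hq0 : 0 < q := by linarith
  rw [eLpNorm_eq_lintegral_rpow_enorm_toReal (by simpa using hq0) ENNReal.ofReal_ne_top,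
    ENNReal.toReal_ofReal hq0.le]
  refine ENNReal.rpow_le_rpow (le_trans (lintegral_mono fun x => ?_) (h.2 k hk)) (by positivity)
  refine ENNReal.rpow_le_rpow ?_ hq0.le
  rw [Real.enorm_of_nonneg (massR_nonneg hg.nonneg γ k x), massE_eq_ofReal (weight_nonneg α) hI]
  exact ENNReal.ofReal_le_ofReal (massR_mono (hg.integrableOn hI) hI hg.le γ k x)

lemma MassBound.tendsto_eLpNorm {γ α q : ℝ} {C : ℝ≥0∞} (h : MassBound γ α q C) (hq : 1 < q)
    {g : ℕ → ℝ → ℝ} (hg : ∀ k, IsWeight α (g k))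
    (hI : IntegrableOn (weight α) (Set.Ioo 0 Real.pi)) {Y : Sample → ℝ}
    (hY : ∀ᵐ x ∂gaussLaw, Tendsto (fun k => massR γ (g k) k x) atTop (𝓝 (Y x)))
    {p : ℝ} (hp : 1 ≤ p) (hpq : p < q) :
    MemLp Y (ENNReal.ofReal q) gaussLaw ∧
      Tendsto (fun k => eLpNorm (fun x => massR γ (g k) k x - Y x) (ENNReal.ofReal p) gaussLaw)
        atTop (𝓝 0) := by
  -- The index is shifted by one because the moment bound starts at `k = 1`.
  have hlim : ∀ᵐ x ∂gaussLaw,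
      Tendsto (fun k => massR γ (g (k + 1)) (k + 1) x) atTop (𝓝 (Y x)) := by
    filter_upwards [hY] with x hx
    exact hx.comp (tendsto_add_atTop_nat 1)
  have key := tendsto_eLpNorm_of_ae_tendsto_of_bdd hp hpq
    (f := fun k => massR γ (g (k + 1)) (k + 1))
    (fun k => (measurable_massR (hg _).measurable (hg _).nonneg ((hg _).integrableOn hI) γ
      _).aestronglyMeasurable)
    (ENNReal.rpow_ne_top_of_nonneg (by positivity) h.1)
    (fun k => h.eLpNorm_le hq (hg _) hI (Nat.le_add_left 1 k)) hlim
  exact ⟨key.1, (tendsto_add_atTop_iff_nat (f := fun k => eLpNorm (fun x =>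
    massR γ (g k) k x - Y x) (ENNReal.ofReal p) gaussLaw) 1).1 key.2⟩

lemma integral_massR {α : ℝ} {g : ℝ → ℝ} (hg : IsWeight α g)
    (hI : IntegrableOn (weight α) (Set.Ioo 0 Real.pi)) (γ : ℝ) (k : ℕ) :
    ∫ x, massR γ g k x ∂gaussLaw = ∫ t in Set.Ioo 0 Real.pi, g t := by
  have h := setIntegral_massR hg hI γ k MeasurableSet.univ
  rw [setIntegral_univ] at h
  rw [h, integral_eq_lintegral_of_nonneg_ae (Eventually.of_forall hg.nonneg)
    hg.measurable.aestronglyMeasurable]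
  simp

lemma MassBound.integral_limMass {γ α q : ℝ} {C : ℝ≥0∞} (h : MassBound γ α q C) (hq : 1 < q)
    {g : ℝ → ℝ} (hg : IsWeight α g) (hI : IntegrableOn (weight α) (Set.Ioo 0 Real.pi)) :
    Integrable (limMass γ g) gaussLaw ∧
      ∫ x, limMass γ g x ∂gaussLaw = ∫ t in Set.Ioo 0 Real.pi, g t := by
  obtain ⟨h1, h2⟩ := h.tendsto_eLpNorm hq (fun _ => hg) hI (ae_tendsto_limMass hg hI γ) le_rfl hq
  have hint : Integrable (limMass γ g) gaussLaw :=
    h1.integrable (by simpa using ENNReal.ofReal_le_ofReal hq.le)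
  refine ⟨hint, ?_⟩
  have h3 := tendsto_integral_of_L1' (limMass γ g) hint.aestronglyMeasurable
    (Eventually.of_forall fun k => integrable_massR hg hI γ k) (l := atTop) (by
      simpa [Pi.sub_def] using! h2)
  simp_rw [integral_massR hg hI] at h3
  exact (tendsto_nhds_unique h3 tendsto_const_nhds)

/-- Monotone limits of weights and limits of masses commute. -/
lemma MassBound.ae_tendsto_limMass_of_monotone {γ α q : ℝ} {C : ℝ≥0∞} (h : MassBound γ α q C)
    (hq : 1 < q) (hI : IntegrableOn (weight α) (Set.Ioo 0 Real.pi)) {g : ℕ → ℝ → ℝ}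
    (hg : ∀ j, IsWeight α (g j)) (hmono : ∀ t ∈ Set.Ioo 0 Real.pi, Monotone fun j => g j t)
    (hlim : ∀ t ∈ Set.Ioo 0 Real.pi, Tendsto (fun j => g j t) atTop (𝓝 (weight α t))) :
    ∀ᵐ x ∂gaussLaw, Tendsto (fun j => limMass γ (g j) x) atTop (𝓝 (limMass γ (weight α) x)) := by
  have hw := isWeight_weight α
  have hae : ∀ᵐ x ∂gaussLaw, ∀ j,
      Tendsto (fun k => massR γ (g j) k x) atTop (𝓝 (limMass γ (g j) x)) :=
    ae_all_iff.2 fun j => ae_tendsto_limMass (hg j) hI γ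
  -- An increasing sequence bounded by an integrable target converges to it almost surely as soon as
  -- its expectations converge to that of the target.
  refine tendsto_of_integral_tendsto_of_monotone (fun j => (h.integral_limMass hq (hg j) hI).1)
    (h.integral_limMass hq hw hI).1 ?_ ?_ ?_
  · simp_rw [fun j => (h.integral_limMass hq (hg j) hI).2, (h.integral_limMass hq hw hI).2]
    refine tendsto_integral_of_dominated_convergence (weight α)
      (fun j => (hg j).measurable.aestronglyMeasurable) hI (fun j => ?_) ?_
    · refine ae_restrict_of_forall_mem measurableSet_Ioo fun t ht => ?_
      rw [Real.norm_of_nonneg ((hg j).nonneg t)]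
      exact (hg j).le t ht
    · exact ae_restrict_of_forall_mem measurableSet_Ioo hlim
  · filter_upwards [hae] with x hx i j hij
    exact le_of_tendsto_of_tendsto' (hx i) (hx j) fun k => massR_mono ((hg i).integrableOn hI)
      ((hg j).integrableOn hI) (fun t ht => hmono t ht hij) γ k x
  · filter_upwards [hae, ae_tendsto_limMass hw hI γ] with x hx hxw j
    exact le_of_tendsto_of_tendsto' (hx j) hxw fun k => massR_mono ((hg j).integrableOn hI)
      hI (hg j).le γ k x

/-! ### Existence of the vague limit -/

/-- Normalized monomials times the weight. -/
def monoWeight (α : ℝ) (n : ℕ) (t : ℝ) : ℝ := |t / Real.pi| ^ n * weight α t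

lemma isWeight_monoWeight (α : ℝ) (n : ℕ) : IsWeight α (monoWeight α n) where
  measurable := by unfold monoWeight; fun_prop
  nonneg t := mul_nonneg (by positivity) (weight_nonneg α t)
  le t ht := by
    refine mul_le_of_le_one_left (weight_nonneg α t) (pow_le_one₀ (abs_nonneg _) ?_)
    rw [abs_of_pos (div_pos ht.1 Real.pi_pos), div_le_one Real.pi_pos]
    exact ht.2.le

lemma integrableOn_mul_wDensity {α : ℝ} (hI : IntegrableOn (weight α) (Set.Ioo 0 Real.pi))
    {f : ℝ → ℝ} (hf : Continuous f) (γ : ℝ) (k : ℕ) (x : Sample) :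
    IntegrableOn (fun t => f t * wDensity γ α k x t) (Set.Ioo 0 Real.pi) :=
  integrableOn_continuous_mul_wickExp_mul hf hI γ k x

lemma setIntegral_polynomial_mul_wDensity {α : ℝ}
    (hI : IntegrableOn (weight α) (Set.Ioo 0 Real.pi)) (γ : ℝ) (x : Sample)
    (hconv : ∀ n, ∃ c, Tendsto (fun k => massR γ (monoWeight α n) k x) atTop (𝓝 c))
    (P : Polynomial ℝ) : ∃ c, Tendsto
      (fun k => ∫ t in Set.Ioo 0 Real.pi, P.eval t * wDensity γ α k x t) atTop (𝓝 c) := by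
  induction P using Polynomial.induction_on' with
  | add P Q hP hQ =>
    obtain ⟨c, hc⟩ := hP
    obtain ⟨d, hd⟩ := hQ
    refine ⟨c + d, (hc.add hd).congr fun k => ?_⟩
    rw [← integral_add (integrableOn_mul_wDensity hI P.continuous γ k x)
      (integrableOn_mul_wDensity hI Q.continuous γ k x)]
    simp only [Polynomial.eval_add, add_mul]
  | monomial n a =>
    obtain ⟨c, hc⟩ := hconv n
    refine ⟨a * Real.pi ^ n * c, (hc.const_mul (a * Real.pi ^ n)).congr fun k => ?_⟩
    rw [massR, ← integral_const_mul]
    refine setIntegral_congr_fun measurableSet_Ioo fun t ht => ?_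
    simp only [Polynomial.eval_monomial, monoWeight, abs_of_pos (div_pos ht.1 Real.pi_pos), div_pow]
    have : wDensity γ α k x t = wickExp γ k x t * weight α t := rfl
    rw [this]
    have := Real.pi_pos
    field_simp

/-- Weierstrass approximation: the total masses converge, hence are bounded in `k`, so a uniform
approximation of `f` on `[0, π]` perturbs all the integrals by a uniformly small amount. -/
lemma exists_tendsto_setIntegral {α : ℝ} (hI : IntegrableOn (weight α) (Set.Ioo 0 Real.pi))
    (γ : ℝ) (x : Sample)
    (hconv : ∀ n, ∃ c, Tendsto (fun k => massR γ (monoWeight α n) k x) atTop (𝓝 c))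
    {f : ℝ → ℝ} (hf : Continuous f) : ∃ c, Tendsto
      (fun k => ∫ t in Set.Ioo 0 Real.pi, f t * wDensity γ α k x t) atTop (𝓝 c) := by
  have hone : ∀ k, massR γ (monoWeight α 0) k x = ∫ t in Set.Ioo 0 Real.pi, wDensity γ α k x t := by
    intro k
    simp only [massR, monoWeight, pow_zero, one_mul]
    rfl
  obtain ⟨B, hB⟩ : ∃ B, ∀ k, ∫ t in Set.Ioo 0 Real.pi, wDensity γ α k x t ≤ B := by
    obtain ⟨c, hc⟩ := hconv 0
    obtain ⟨B, hB⟩ := hc.bddAbove_range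
    exact ⟨B, fun k => by rw [← hone]; exact hB ⟨k, rfl⟩⟩
  have hw0 : ∀ k t, 0 ≤ wDensity γ α k x t := fun k t =>
    mul_nonneg (wickExp_pos _ _ _ _).le (weight_nonneg α t)
  have hB0 : 0 ≤ B := (integral_nonneg (hw0 0)).trans (hB 0)
  have hwi : ∀ k, IntegrableOn (wDensity γ α k x) (Set.Ioo 0 Real.pi) := fun k =>
    integrableOn_wickExp_mul hI γ k x
  apply cauchySeq_tendsto_of_complete
  rw [Metric.cauchySeq_iff']
  intro ε hε
  obtain ⟨P, hP⟩ := exists_polynomial_near_of_continuousOn 0 Real.pi f hf.continuousOn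
    (ε / (4 * (B + 1))) (by positivity)
  have happrox : ∀ k, |(∫ t in Set.Ioo 0 Real.pi, P.eval t * wDensity γ α k x t) -
      ∫ t in Set.Ioo 0 Real.pi, f t * wDensity γ α k x t| ≤ ε / 4 := by
    intro k
    rw [← integral_sub (integrableOn_mul_wDensity hI P.continuous γ k x)
      (integrableOn_mul_wDensity hI hf γ k x), ← Real.norm_eq_abs]
    calc _ ≤ ∫ t in Set.Ioo 0 Real.pi, ε / (4 * (B + 1)) * wDensity γ α k x t := by
          refine norm_integral_le_of_norm_le ((hwi k).const_mul _) ?_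
          refine ae_restrict_of_forall_mem measurableSet_Ioo fun t ht => ?_
          rw [← sub_mul, norm_mul, Real.norm_of_nonneg (hw0 k t), Real.norm_eq_abs]
          exact mul_le_mul_of_nonneg_right (hP t (Set.Ioo_subset_Icc_self ht)).le (hw0 k t)
      _ ≤ ε / (4 * (B + 1)) * B := by
          rw [integral_const_mul]
          exact mul_le_mul_of_nonneg_left (hB k) (by positivity)
      _ ≤ ε / 4 := by
          rw [div_mul_eq_mul_div, div_le_div_iff₀ (by positivity) (by norm_num)]
          nlinarith
  obtain ⟨c, hc⟩ := setIntegral_polynomial_mul_wDensity hI γ x hconv P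
  obtain ⟨N, hN⟩ := Metric.cauchySeq_iff'.1 hc.cauchySeq (ε / 4) (by positivity)
  refine ⟨N, fun k hk => ?_⟩
  have h1 := hN k hk
  have h2 := happrox k
  have h3 := happrox N
  rw [Real.dist_eq] at h1 ⊢
  rw [abs_lt] at h1 ⊢
  rw [abs_le] at h2 h3
  constructor <;> linarith [h1.1, h1.2, h2.1, h2.2, h3.1, h3.2]

open scoped CompactlySupported in
lemma exists_isVagueLimit {α : ℝ} (hI : IntegrableOn (weight α) (Set.Ioo 0 Real.pi))
    (γ : ℝ) (x : Sample)
    (hconv : ∀ n, ∃ c, Tendsto (fun k => massR γ (monoWeight α n) k x) atTop (𝓝 c)) :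
    ∃ M, IsVagueLimit γ α x M := by
  choose! lim hlim using fun (f : ℝ → ℝ) (hf : Continuous f) =>
    exists_tendsto_setIntegral hI γ x hconv hf
  have hw0 : ∀ k t, 0 ≤ wDensity γ α k x t := fun k t =>
    mul_nonneg (wickExp_pos _ _ _ _).le (weight_nonneg α t)
  let L : C_c(ℝ, ℝ) →ₗ[ℝ] ℝ :=
    { toFun := fun f => lim f
      map_add' := fun f g => by
        refine tendsto_nhds_unique (hlim _ (f + g).continuous)
          (((hlim _ f.continuous).add (hlim _ g.continuous)).congr fun k => ?_)
        rw [← integral_add (integrableOn_mul_wDensity hI f.continuous γ k x)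
          (integrableOn_mul_wDensity hI g.continuous γ k x)]
        simp only [CompactlySupportedContinuousMap.coe_add, Pi.add_apply, add_mul]
        rfl
      map_smul' := fun a f => by
        refine tendsto_nhds_unique (hlim _ (a • f).continuous)
          (((hlim _ f.continuous).const_mul a).congr fun k => ?_)
        rw [← integral_const_mul]
        simp only [CompactlySupportedContinuousMap.coe_smul, Pi.smul_apply, smul_eq_mul, mul_assoc]
        rfl }
  let Λ : C_c(ℝ, ℝ) →ₚ[ℝ] ℝ := PositiveLinearMap.mk₀ L fun f hf => by
    refine ge_of_tendsto' (hlim _ f.continuous) fun k => ?_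
    exact integral_nonneg fun t => mul_nonneg (hf t) (hw0 k t)
  -- The functional is defined on test functions of the whole line, so its representing measure is
  -- restricted to the open interval; test functions supported there do not see the difference.
  refine ⟨(RealRMK.rieszMeasure Λ).restrict (Set.Ioo 0 Real.pi), ?_, ?_, ?_⟩
  · rw [Measure.restrict_apply measurableSet_Ioo.compl, Set.compl_inter_self, measure_empty]
  · intro K hK _
    exact (Measure.restrict_apply_le _ _).trans_lt hK.measure_lt_top
  · intro f hf hfc hfs
    have h1 : ∫ t, f t ∂(RealRMK.rieszMeasure Λ).restrict (Set.Ioo 0 Real.pi) = lim f := by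
      rw [setIntegral_eq_integral_of_forall_compl_eq_zero fun t ht => by
        by_contra h0
        exact ht (hfs (subset_tsupport _ h0))]
      exact RealRMK.integral_rieszMeasure Λ ⟨⟨f, hf⟩, hfc⟩
    rw [h1]
    exact hlim f hf

/-! ### The total mass of the chaos -/

/-- Continuous cutoffs with compact support in `(0, π)`, increasing to `1`. -/
def cutoff (j : ℕ) (t : ℝ) : ℝ := max 0 (min 1 (j * min t (Real.pi - t) - 1))

@[fun_prop]
lemma continuous_cutoff (j : ℕ) : Continuous (cutoff j) := by unfold cutoff; fun_prop

lemma cutoff_nonneg (j : ℕ) (t : ℝ) : 0 ≤ cutoff j t := le_max_left _ _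

lemma cutoff_le_one (j : ℕ) (t : ℝ) : cutoff j t ≤ 1 :=
  max_le zero_le_one (min_le_left _ _)

/-- The `- 1` in `cutoff` keeps the support in the closed set where `j * min t (π - t) ≥ 1`, which
is empty for `j = 0`. -/
lemma tsupport_cutoff_subset (j : ℕ) : tsupport (cutoff j) ⊆ Set.Ioo 0 Real.pi := by
  have hsub : tsupport (cutoff j) ⊆ {t | 1 ≤ j * min t (Real.pi - t)} := by
    refine closure_minimal (fun t ht => ?_) (isClosed_le continuous_const (by fun_prop))
    by_contra h
    rw [Set.mem_ofPred_eq, not_le] at h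
    exact ht (max_eq_left ((min_le_right _ _).trans (by linarith)))
  refine hsub.trans fun t ht => ?_
  rw [Set.mem_ofPred_eq] at ht
  have h1 : 0 < min t (Real.pi - t) := by
    by_contra h
    have := mul_nonpos_of_nonneg_of_nonpos (Nat.cast_nonneg (α := ℝ) j) (not_lt.1 h)
    linarith
  obtain ⟨h2, h3⟩ := lt_min_iff.1 h1
  exact ⟨h2, by linarith⟩

lemma isCompact_tsupport_cutoff (j : ℕ) : IsCompact (tsupport (cutoff j)) :=
  (isCompact_Icc (a := 0) (b := Real.pi)).of_isClosed_subset (isClosed_tsupport _)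
    ((tsupport_cutoff_subset j).trans Set.Ioo_subset_Icc_self)

lemma cutoff_monotone {t : ℝ} (ht : t ∈ Set.Ioo 0 Real.pi) : Monotone fun j => cutoff j t := by
  intro i j hij
  have h1 : 0 < min t (Real.pi - t) := lt_min ht.1 (by linarith [ht.2])
  have h2 : (i : ℝ) ≤ j := by exact_mod_cast hij
  exact max_le_max le_rfl (min_le_min le_rfl (by nlinarith))

lemma cutoff_eq_one {j : ℕ} {t : ℝ} (h : 2 ≤ j * min t (Real.pi - t)) : cutoff j t = 1 := by
  rw [cutoff, min_eq_left (by linarith), max_eq_right zero_le_one]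

lemma tendsto_cutoff {t : ℝ} (ht : t ∈ Set.Ioo 0 Real.pi) :
    Tendsto (fun j => cutoff j t) atTop (𝓝 1) := by
  have h1 : 0 < min t (Real.pi - t) := lt_min ht.1 (by linarith [ht.2])
  refine tendsto_const_nhds.congr' ?_
  obtain ⟨N, hN⟩ := exists_nat_ge (2 / min t (Real.pi - t))
  filter_upwards [eventually_ge_atTop N] with j hj
  refine (cutoff_eq_one ?_).symm
  rw [div_le_iff₀ h1] at hN
  have h2 : (N : ℝ) ≤ j := by exact_mod_cast hj
  nlinarith

lemma isWeight_cutoff_mul (α : ℝ) (j : ℕ) : IsWeight α (fun t => cutoff j t * weight α t) where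
  measurable := (continuous_cutoff j).measurable.mul (measurable_weight α)
  nonneg t := mul_nonneg (cutoff_nonneg j t) (weight_nonneg α t)
  le t _ := mul_le_of_le_one_left (weight_nonneg α t) (cutoff_le_one j t)

lemma IsVagueLimit.ofReal_eq_lintegral_cutoff {γ α : ℝ} {x : Sample} {M : Measure ℝ}
    (hM : IsVagueLimit γ α x M) {j : ℕ} {y : ℝ}
    (hy : Tendsto (fun k => massR γ (fun t => cutoff j t * weight α t) k x) atTop (𝓝 y)) :
    ENNReal.ofReal y = ∫⁻ t, ENNReal.ofReal (cutoff j t) ∂M := by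
  have hint : Integrable (cutoff j) M := by
    rw [← integrableOn_iff_integrable_of_support_subset (subset_tsupport (cutoff j))]
    refine Measure.integrableOn_of_bounded (M := 1)
      (hM.finite_of_isCompact _ (isCompact_tsupport_cutoff j) (tsupport_cutoff_subset j)).ne
      (continuous_cutoff j).aestronglyMeasurable (Eventually.of_forall fun t => ?_)
    rw [Real.norm_of_nonneg (cutoff_nonneg j t)]
    exact cutoff_le_one j t
  have h1 := hM.tendsto (cutoff j) (continuous_cutoff j) (isCompact_tsupport_cutoff j)
    (tsupport_cutoff_subset j)
  have h2 : ∀ k, ∫ t in Set.Ioo 0 Real.pi, cutoff j t * wDensity γ α k x t =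
      massR γ (fun t => cutoff j t * weight α t) k x := by
    intro k
    refine integral_congr_ae (Eventually.of_forall fun t => ?_)
    have : wDensity γ α k x t = wickExp γ k x t * weight α t := rfl
    simp only [this]
    ring
  simp_rw [h2] at h1
  rw [tendsto_nhds_unique hy h1, ofReal_integral_eq_lintegral_ofReal hint
    (Eventually.of_forall (cutoff_nonneg j))]

/-- A closed subset of the interval is compact, so some cutoff equals `1` on it; conversely each
cutoff is at most the indicator of its closed support. -/
lemma IsVagueLimit.iSup_isClosed_eq {γ α : ℝ} {x : Sample} {M : Measure ℝ}
    (hM : IsVagueLimit γ α x M) {u : ℕ → ℝ} {y : ℝ}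
    (hu : ∀ j, Tendsto (fun k => massR γ (fun t => cutoff j t * weight α t) k x) atTop (𝓝 (u j)))
    (huy : ∀ j, u j ≤ y) (hy : Tendsto u atTop (𝓝 y)) :
    ⨆ (B : Set ℝ) (_ : IsClosed B) (_ : B ⊆ Set.Ioo 0 Real.pi), M B = ENNReal.ofReal y := by
  refine le_antisymm (iSup_le fun B => iSup_le fun hB => iSup_le fun hBs => ?_) ?_
  · obtain ⟨j, hj⟩ : ∃ j : ℕ, ∀ t ∈ B, cutoff j t = 1 := by
      rcases B.eq_empty_or_nonempty with rfl | hne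
      · exact ⟨0, by simp⟩
      · have hc : IsCompact B := (isCompact_Icc (a := 0) (b := Real.pi)).of_isClosed_subset hB
          (hBs.trans Set.Ioo_subset_Icc_self)
        obtain ⟨b, hb, hmin⟩ := hc.exists_isMinOn hne
          (f := fun t => min t (Real.pi - t)) (by fun_prop)
        have h1 : 0 < min b (Real.pi - b) := lt_min (hBs hb).1 (by linarith [(hBs hb).2])
        obtain ⟨N, hN⟩ := exists_nat_ge (2 / min b (Real.pi - b))
        rw [div_le_iff₀ h1] at hN
        refine ⟨N, fun t ht => cutoff_eq_one (hN.trans ?_)⟩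
        exact mul_le_mul_of_nonneg_left (hmin ht) (Nat.cast_nonneg _)
    calc M B = ∫⁻ t in B, 1 ∂M := by simp
      _ = ∫⁻ t in B, ENNReal.ofReal (cutoff j t) ∂M :=
          setLIntegral_congr_fun hB.measurableSet fun t ht => by simp [hj t ht]
      _ ≤ ∫⁻ t, ENNReal.ofReal (cutoff j t) ∂M := setLIntegral_le_lintegral _ _
      _ = ENNReal.ofReal (u j) := (hM.ofReal_eq_lintegral_cutoff (hu j)).symm
      _ ≤ _ := ENNReal.ofReal_le_ofReal (huy j)
  · refine le_of_tendsto' (ENNReal.tendsto_ofReal hy) fun j => ?_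
    rw [hM.ofReal_eq_lintegral_cutoff (hu j)]
    calc _ ≤ ∫⁻ t, (tsupport (cutoff j)).indicator 1 t ∂M := by
          refine lintegral_mono fun t => ?_
          by_cases ht : t ∈ tsupport (cutoff j)
          · rw [Set.indicator_of_mem ht]
            exact ENNReal.ofReal_le_one.2 (cutoff_le_one j t)
          · rw [image_eq_zero_of_notMem_tsupport ht]
            simp
      _ = M (tsupport (cutoff j)) := lintegral_indicator_one (isClosed_tsupport _).measurableSet
      _ ≤ _ := le_iSup_of_le (tsupport (cutoff j)) (by
          rw [iSup_pos (isClosed_tsupport _), iSup_pos (tsupport_cutoff_subset j)])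

/-! ### The regularized masses -/

/-- The regularized weight `(1 / (2 |sin t| + 1 / k)) ^ α`. -/
def regWeight (α : ℝ) (k : ℕ) (t : ℝ) : ℝ := (1 / (2 * |Real.sin t| + 1 / (k : ℝ))) ^ α

lemma regWeight_mono {α : ℝ} (hα : 0 < α) {i j : ℕ} (hi : 1 ≤ i) (hij : i ≤ j) {t : ℝ}
    (ht : t ∈ Set.Ioo 0 Real.pi) : regWeight α i t ≤ regWeight α j t := by
  have hs := Real.sin_pos_of_mem_Ioo ht
  have hi0 : (0 : ℝ) < i := by exact_mod_cast hi
  have h1 : (i : ℝ) ≤ j := by exact_mod_cast hij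
  unfold regWeight
  gcongr

/-- The case `k = 0` is covered: there `1 / k` is `0` and the regularized weight is `weight α`.
Monotonicity in `k` holds only from `k = 1` on. -/
lemma isWeight_regWeight {α : ℝ} (hα : 0 < α) (k : ℕ) : IsWeight α (regWeight α k) where
  measurable := by unfold regWeight; fun_prop
  nonneg t := by unfold regWeight; positivity
  le t ht := by
    have hs := Real.sin_pos_of_mem_Ioo ht
    have hs' : 0 < |Real.sin t| := abs_pos.2 hs.ne'
    unfold regWeight weight
    gcongr
    simp

lemma tendsto_regWeight {α t : ℝ} (hα : 0 < α) (ht : t ∈ Set.Ioo 0 Real.pi) :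
    Tendsto (fun k => regWeight α (k + 1) t) atTop (𝓝 (weight α t)) := by
  have hs' : 0 < |Real.sin t| := abs_pos.2 (Real.sin_pos_of_mem_Ioo ht).ne'
  have h1 : Tendsto (fun k : ℕ => 2 * |Real.sin t| + 1 / ((k + 1 : ℕ) : ℝ)) atTop
      (𝓝 (2 * |Real.sin t| + 0)) := by
    refine tendsto_const_nhds.add ?_
    simpa using tendsto_one_div_add_atTop_nhds_zero_nat (𝕜 := ℝ)
  rw [add_zero] at h1
  exact (tendsto_const_nhds.div h1 (by positivity)).rpow_const (Or.inr hα.le)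

lemma wMass_eq_massR (γ α : ℝ) : wMass γ α = massR γ (weight α) := by
  ext k x
  rw [wMass, intervalIntegral.integral_of_le Real.pi_pos.le, integral_Ioc_eq_integral_Ioo]
  rfl

lemma vMass_eq_massR (γ α : ℝ) (k : ℕ) : vMass γ α k = massR γ (regWeight α k) k := by
  ext x
  rw [vMass, intervalIntegral.integral_of_le Real.pi_pos.le, integral_Ioc_eq_integral_Ioo]
  rfl

/-- For `k ≥ j + 1` the mass with weight `regWeight α k` lies between those with weights `regWeight
α (j + 1)` and `weight α`. Letting `k`, then `j`, tend to infinity closes the gap. -/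
lemma MassBound.ae_tendsto_vMass {γ α q : ℝ} {C : ℝ≥0∞} (h : MassBound γ α q C) (hq : 1 < q)
    (hα : 0 < α) (hI : IntegrableOn (weight α) (Set.Ioo 0 Real.pi)) :
    ∀ᵐ x ∂gaussLaw, Tendsto (fun k => massR γ (regWeight α k) k x) atTop
      (𝓝 (limMass γ (weight α) x)) := by
  have h1 := h.ae_tendsto_limMass_of_monotone hq hI (g := fun j => regWeight α (j + 1))
    (fun j => isWeight_regWeight hα (j + 1))
    (fun t ht i j hij => regWeight_mono hα (Nat.le_add_left 1 i) (Nat.succ_le_succ hij) ht)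
    (fun t ht => tendsto_regWeight hα ht)
  have h2 : ∀ᵐ x ∂gaussLaw, ∀ j, Tendsto (fun k => massR γ (regWeight α (j + 1)) k x) atTop
      (𝓝 (limMass γ (regWeight α (j + 1)) x)) :=
    ae_all_iff.2 fun j => ae_tendsto_limMass (isWeight_regWeight hα (j + 1)) hI γ
  filter_upwards [h1, h2, ae_tendsto_limMass (isWeight_weight α) hI γ] with x hx1 hx2 hx3
  refine tendsto_order.2 ⟨fun a ha => ?_, fun a ha => ?_⟩
  · obtain ⟨j, hj⟩ := (hx1.eventually (lt_mem_nhds ha)).exists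
    filter_upwards [(hx2 j).eventually (lt_mem_nhds hj), eventually_ge_atTop (j + 1)] with k hk hjk
    exact hk.trans_le (massR_mono ((isWeight_regWeight hα _).integrableOn hI)
      ((isWeight_regWeight hα _).integrableOn hI)
      (fun t ht => regWeight_mono hα (Nat.le_add_left 1 j) hjk ht) γ k x)
  · filter_upwards [hx3.eventually (gt_mem_nhds ha)] with k hk
    exact (massR_mono ((isWeight_regWeight hα _).integrableOn hI) hI
      (isWeight_regWeight hα _).le γ k x).trans_lt hk

lemma ae_isVagueLimit_chaos {α : ℝ} (hI : IntegrableOn (weight α) (Set.Ioo 0 Real.pi)) (γ : ℝ) :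
    ∀ᵐ x ∂gaussLaw, IsVagueLimit γ α x (chaos γ α x) := by
  have h : ∀ᵐ x ∂gaussLaw, ∀ n, Tendsto (fun k => massR γ (monoWeight α n) k x) atTop
      (𝓝 (limMass γ (monoWeight α n) x)) :=
    ae_all_iff.2 fun n => ae_tendsto_limMass (isWeight_monoWeight α n) hI γ
  filter_upwards [h] with x hx
  have hex := exists_isVagueLimit hI γ x fun n => ⟨_, hx n⟩
  rw [chaos, dif_pos hex]
  exact hex.choose_spec

lemma MassBound.ae_chaosMass_eq {γ α q : ℝ} {C : ℝ≥0∞} (h : MassBound γ α q C) (hq : 1 < q)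
    (hI : IntegrableOn (weight α) (Set.Ioo 0 Real.pi)) :
    ∀ᵐ x ∂gaussLaw, chaosMass γ α x = ENNReal.ofReal (limMass γ (weight α) x) := by
  have h1 := h.ae_tendsto_limMass_of_monotone hq hI (g := fun j t => cutoff j t * weight α t)
    (isWeight_cutoff_mul α)
    (fun t ht i j hij => mul_le_mul_of_nonneg_right (cutoff_monotone ht hij) (weight_nonneg α t))
    (fun t ht => by simpa using (tendsto_cutoff ht).mul_const (weight α t))
  have h2 : ∀ᵐ x ∂gaussLaw, ∀ j, Tendsto
      (fun k => massR γ (fun t => cutoff j t * weight α t) k x) atTop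
      (𝓝 (limMass γ (fun t => cutoff j t * weight α t) x)) :=
    ae_all_iff.2 fun j => ae_tendsto_limMass (isWeight_cutoff_mul α j) hI γ
  filter_upwards [h1, h2, ae_tendsto_limMass (isWeight_weight α) hI γ,
    ae_isVagueLimit_chaos hI γ] with x hx1 hx2 hx3 hx4
  refine hx4.iSup_isClosed_eq hx2 (fun j => ?_) hx1
  exact le_of_tendsto_of_tendsto' (hx2 j) hx3 fun k => massR_mono
    ((isWeight_cutoff_mul α j).integrableOn hI) hI (isWeight_cutoff_mul α j).le γ k x

/-! ### Admissible exponents -/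

lemma one_lt_pTwo {γ α : ℝ} (hγ : 0 < γ) (hα : 0 < α) (hα1 : α < 1) : 1 < pTwo γ α := by
  have hγ2 : 0 < γ ^ 2 := by positivity
  have h1 : α / γ ^ 2 < 1 / γ ^ 2 := div_lt_div_of_pos_right hα1 hγ2
  have h0 : 0 < α / γ ^ 2 := by positivity
  have h2 : 1 / 2 * (1 + α / γ ^ 2) <
      Real.sqrt (1 / γ ^ 2 + 1 / 4 * (1 - α / γ ^ 2) ^ 2) := by
    apply Real.lt_sqrt_of_sq_lt
    nlinarith
  unfold pTwo
  linarith

/-- `pTwo` is the positive root of `γ² q (q - 1) + α q = 1`; isolating the square root and squaring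
gives the inequality. -/
lemma lt_one_of_lt_pTwo {γ α q : ℝ} (hγ : 0 < γ) (hα : 0 < α) (hq : 1 < q)
    (h : q < pTwo γ α) : γ ^ 2 * (q * (q - 1)) + α * q < 1 := by
  have hγ2 : 0 < γ ^ 2 := by positivity
  set a := α / γ ^ 2 with ha
  have ha0 : 0 < a := by positivity
  unfold pTwo at h
  rw [← ha] at h
  have h1 : q - 1 / 2 * (1 - a) < Real.sqrt (1 / γ ^ 2 + 1 / 4 * (1 - a) ^ 2) := by linarith
  have h2 : 0 ≤ q - 1 / 2 * (1 - a) := by linarith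
  rw [Real.lt_sqrt h2] at h1
  have h3 : q * (q - 1) + a * q < 1 / γ ^ 2 := by nlinarith
  rw [lt_div_iff₀ hγ2] at h3
  have h4 : a * γ ^ 2 = α := div_mul_cancel₀ _ hγ2.ne'
  calc γ ^ 2 * (q * (q - 1)) + α * q = (q * (q - 1) + a * q) * γ ^ 2 := by rw [← h4]; ring
    _ < 1 := h3

lemma exists_massBound {γ α p : ℝ} (hγ : 0 < γ) (hγ_lt : γ < Real.sqrt 2) (hα : 0 < α)
    (hα1 : α < 1) (hp1 : p < pTwo γ α) (hp2 : p < 2 / γ ^ 2) :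
    ∃ q C, 1 < q ∧ p < q ∧ MassBound γ α q C := by
  have hγ2 : 0 < γ ^ 2 := by positivity
  have hγ2' : γ ^ 2 < 2 := by
    have := Real.sq_sqrt (show (0 : ℝ) ≤ 2 by norm_num)
    nlinarith
  set m := max p 1 with hm
  set N := ⌊m⌋₊ with hN
  have hm1 : 1 ≤ m := le_max_right _ _
  have hN1 : (N : ℝ) ≤ m := Nat.floor_le (by linarith)
  have hN2 : m < N + 1 := Nat.lt_floor_add_one _
  have hN0 : 1 ≤ N := Nat.le_floor (by simpa using hm1)
  -- The third bound keeps `q` strictly between the integers `N` and `N + 1`, so that `q - N` is an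
  -- admissible starting order in `(0, 1)`.
  set u := min (min (pTwo γ α) (2 / γ ^ 2)) (N + 1 : ℝ) with hu
  have hmu : m < u := by
    refine lt_min (lt_min (max_lt hp1 (one_lt_pTwo hγ hα hα1)) (max_lt hp2 ?_)) hN2
    rw [lt_div_iff₀ hγ2]; linarith
  obtain ⟨q, hq1, hq2⟩ := exists_between hmu
  obtain ⟨n, hn⟩ := Nat.exists_eq_add_of_le' hN0
  have hqu := (lt_min_iff.1 hq2)
  have hqu' := lt_min_iff.1 hqu.1
  have hNn : (N : ℝ) = n + 1 := by rw [hn]; push_cast; ring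
  have hqs : (q - N) + n + 1 = q := by rw [hNn]; ring
  have hqs' : (q - N) + n = q - 1 := by linarith
  have h1q : 1 < q := by linarith
  obtain ⟨C, hC, hb⟩ := exists_lintegral_massE_rpow_le (s := q - N) hγ hα (by linarith)
    (by linarith) n (by
      rw [hqs]
      have := hqu'.2
      rw [lt_div_iff₀ hγ2] at this
      linarith) (by
      rw [hqs, hqs']
      exact lt_one_of_lt_pTwo hγ hα h1q hqu'.1)
  rw [hqs] at hb
  exact ⟨q, C, h1q, (le_max_left _ _).trans_lt hq1, hC, hb⟩

end HalfCircleGMC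

end

open MeasureTheory Filter Topology HalfCircleGMC in
theorem mainTheorem10 (γ α : ℝ) (hγ : 0 < γ) (hγ_lt : γ < Real.sqrt 2)
    (hα : 0 < α) (hα_lt : α < 1) :
    -- the limit measure exists almost surely
    (∀ᵐ x ∂gaussLaw, IsVagueLimit γ α x (chaos γ α x)) ∧
    -- almost sure finiteness of the limit mass, and both almost sure convergences
    (∀ᵐ x ∂gaussLaw, chaosMass γ α x ≠ ⊤ ∧
      Tendsto (fun k : ℕ => vMass γ α k x) atTop (𝓝 (chaosMass γ α x).toReal) ∧
      Tendsto (fun k : ℕ => wMass γ α k x) atTop (𝓝 (chaosMass γ α x).toReal)) ∧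
    1 < pTwo γ α ∧
    -- both convergences in `L^p`
    ∀ p : ℝ, 0 < p → p < pTwo γ α → p < 2 / γ ^ 2 →
      MemLp (fun x => (chaosMass γ α x).toReal) (ENNReal.ofReal p) gaussLaw ∧
      (∀ k : ℕ, 1 ≤ k →
        MemLp (vMass γ α k) (ENNReal.ofReal p) gaussLaw ∧
        MemLp (wMass γ α k) (ENNReal.ofReal p) gaussLaw) ∧
      Tendsto (fun k : ℕ => eLpNorm (fun x => vMass γ α k x - (chaosMass γ α x).toReal)
        (ENNReal.ofReal p) gaussLaw) atTop (𝓝 0) ∧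
      Tendsto (fun k : ℕ => eLpNorm (fun x => wMass γ α k x - (chaosMass γ α x).toReal)
        (ENNReal.ofReal p) gaussLaw) atTop (𝓝 0) := by
  have hI := integrableOn_weight hα hα_lt
  have hw := isWeight_weight α
  have hreg : ∀ k, IsWeight α (regWeight α k) := isWeight_regWeight hα
  have hp2 := one_lt_pTwo hγ hα hα_lt
  have hγ2 : 1 < 2 / γ ^ 2 := by
    have h2 := Real.sq_sqrt (show (0 : ℝ) ≤ 2 by norm_num)
    rw [lt_div_iff₀ (by positivity)]
    nlinarith
  -- The almost sure statements need only some bounded moment of order above `1`, available since `1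
  -- < pTwo` and `γ² < 2`.
  obtain ⟨q₁, C₁, hq₁, -, hb₁⟩ := exists_massBound hγ hγ_lt hα hα_lt hp2 hγ2
  have hW := ae_tendsto_limMass hw hI γ
  have hV := hb₁.ae_tendsto_vMass hq₁ hα hI
  have hmass : ∀ᵐ x ∂gaussLaw, chaosMass γ α x = ENNReal.ofReal (limMass γ (weight α) x) ∧
      (chaosMass γ α x).toReal = limMass γ (weight α) x := by
    filter_upwards [hb₁.ae_chaosMass_eq hq₁ hI, hW] with x hx hxW
    refine ⟨hx, ?_⟩
    rw [hx, ENNReal.toReal_ofReal (ge_of_tendsto' hxW fun k => massR_nonneg hw.nonneg γ k x)]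
  simp_rw [wMass_eq_massR, vMass_eq_massR]
  refine ⟨ae_isVagueLimit_chaos hI γ, ?_, hp2, fun p hp0 hp hpγ => ?_⟩
  · filter_upwards [hmass, hW, hV] with x hx hxW hxV
    rw [hx.2]
    exact ⟨by rw [hx.1]; exact ENNReal.ofReal_ne_top, hxV, hxW⟩
  · obtain ⟨q, C, hq, hpq, hb⟩ := exists_massBound hγ hγ_lt hα hα_lt hp hpγ
    have hpq' : ENNReal.ofReal p ≤ ENNReal.ofReal q := ENNReal.ofReal_le_ofReal hpq.le
    have hmem : ∀ (g : ℝ → ℝ), IsWeight α g → ∀ k, 1 ≤ k →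
        MemLp (massR γ g k) (ENNReal.ofReal p) gaussLaw := fun g hg k hk =>
      MemLp.mono_exponent ⟨(measurable_massR hg.measurable hg.nonneg (hg.integrableOn hI) γ
        k).aestronglyMeasurable, (hb.eLpNorm_le hq hg hI hk).trans_lt
        (ENNReal.rpow_lt_top_of_nonneg (by positivity) hb.1)⟩ hpq'
    have hconv : ∀ g : ℕ → ℝ → ℝ, (∀ k, IsWeight α (g k)) →
        (∀ᵐ x ∂gaussLaw, Tendsto (fun k => massR γ (g k) k x) atTop
          (𝓝 (limMass γ (weight α) x))) →
        MemLp (fun x => (chaosMass γ α x).toReal) (ENNReal.ofReal p) gaussLaw ∧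
        Tendsto (fun k => eLpNorm (fun x => massR γ (g k) k x - (chaosMass γ α x).toReal)
          (ENNReal.ofReal p) gaussLaw) atTop (𝓝 0) := by
      intro g hg hlim
      have hlim' : ∀ᵐ x ∂gaussLaw, Tendsto (fun k => massR γ (g k) k x) atTop
          (𝓝 (chaosMass γ α x).toReal) := by
        filter_upwards [hlim, hmass] with x hx hx2
        rwa [hx2.2]
      -- For `p < 1` convergence is proved at exponent `max p 1 = 1` and passed down, the measure
      -- being a probability.
      obtain ⟨h1, h2⟩ := hb.tendsto_eLpNorm hq hg hI hlim' (le_max_right p 1) (max_lt hpq hq)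
      refine ⟨h1.mono_exponent hpq', tendsto_of_tendsto_of_tendsto_of_le_of_le tendsto_const_nhds h2
        (fun _ => zero_le) fun k => ?_⟩
      exact eLpNorm_le_eLpNorm_of_exponent_le (ENNReal.ofReal_le_ofReal (le_max_left _ _))
        (((measurable_massR (hg k).measurable (hg k).nonneg ((hg k).integrableOn hI) γ
          k).aestronglyMeasurable).sub h1.1)
    exact ⟨(hconv _ (fun _ => hw) hW).1, fun k hk => ⟨hmem _ (hreg k) k hk, hmem _ hw k hk⟩,
      (hconv _ hreg hV).2, (hconv _ (fun _ => hw) hW).2⟩
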